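/- **Setting.** Let $\mathcal A$ be a finite nonempty action set, $\mathcal X$ a measurable context space, $\nu$ a probability distribution on $\mathcal X$, and let $r:\mathcal X\times\mathcal A\to[0,1]$ and $\boldsymbol c:\mathcal X\times\mathcal A\to[-1,1]^d$ be measurable expected-reward and expected-cost functions. Let $T$ be the number of rounds and $\boldsymbol B\in[0,1]^d$ the vector of average cost constraints. Inequalities between vectors, and positive parts $(\cdot)_+$ of vectors, are componentwise; $\|\cdot\|$ is the Euclidean norm and $\boldsymbol 1=(1,\dots,1)$. In each round $t=1,\dots,T$ a context $\boldsymbol x_t\sim\nu$ is drawn independently of the past, the learner picks an action $a_t\in\mathcal A$, and then observes a reward $r_t\in[0,1]$ and a cost vector $\boldsymbol c_t\in[-1,1]^d$ whose conditional expectations given the past, $\boldsymbol x_t$ and $a_t$ are $r(\boldsymbol x_t,a_t)$ and $\boldsymbol c(\boldsymbol x_t,a_t)$. **Estimation assumption.** An estimation procedure is given: estimates $\hat r_t:\mathcal X\times\mathcal A\to[0,1]$ and $\hat{\boldsymbol c}_t:\mathcal X\times\mathcal A\to[-1,1]^d$ that are functions of $(\boldsymbol x_s,a_s,r_s,\boldsymbol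 c_s)_{s\le t}$, and error functions $\epsilon_t:\mathcal X\times\mathcal A\times(0,1]\to[0,1]$ that are functions of $(\boldsymbol x_s,a_s)_{s\le t}$, $t=0,1,2,\dots$. It is assumed that, in whatever way contexts and actions are picked (rewards and costs being generated as above), for all $\delta\in(0,1]$, with probability at least $1-\delta$, for all $0\le t\le T$, $\boldsymbol x\in\mathcal X$ and $a\in\mathcal A$, $$|\hat r_t(\boldsymbol x,a)-r(\boldsymbol x,a)|\le\epsilon_t(\boldsymbol x,a,\delta)\quad\text{and}\quad|\hat{\boldsymbol c}_t(\boldsymbol x,a)-\boldsymbol c(\boldsymbol x,a)|\le\epsilon_t(\boldsymbol x,a,\delta)\,\boldsymbol 1 .$$ Let $\beta_{T,\delta}=\sum_{t=1}^T\epsilon_{t-1}(\boldsymbol x_t,a_t,\delta)$. **Strategy.** With $\operatorname{clip}[x]_\ell^u=\min\{\max\{x,\ell\},u\}$ (componentwise for vectors), put $\hat r^{\rm ucb}_{\delta,t}=\operatorname{clip}[\hat r_t+\epsilon_t(\cdot,\cdot,\delta)]_0^1$ and $\hat{\boldsymbol c}^{\rm lcb}_{\delta,t}=\operatorname{clip}[\hat{\boldsymbol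 c}_t-\epsilon_t(\cdot,\cdot,\delta)\boldsymbol 1]_{-1}^1$. The strategy with step size $\gamma>0$, margin $b$ and confidence parameter $\delta$ starts from $\boldsymbol\lambda_0=\boldsymbol 0$ and, in rounds $t=1,\dots,T$, picks an action $a_t$ maximizing over $a\in\mathcal A$ $$\hat r^{\rm ucb}_{\delta,t-1}(\boldsymbol x_t,a)-\bigl\langle\hat{\boldsymbol c}^{\rm lcb}_{\delta,t-1}(\boldsymbol x_t,a)-(\boldsymbol B-b\boldsymbol 1),\boldsymbol\lambda_{t-1}\bigr\rangle$$ and then sets $\boldsymbol\lambda_t=\bigl(\boldsymbol\lambda_{t-1}+\gamma(\hat{\boldsymbol c}^{\rm lcb}_{\delta,t-1}(\boldsymbol x_t,a_t)-(\boldsymbol B-b\boldsymbol 1))\bigr)_+$. **Lemma.** Fix $\delta\in(0,1)$, $\gamma>0$ and $b$ with $0<b<\min_i B_i$. Suppose that the estimation assumption holds and that the problem is feasible for some $\boldsymbol B'<\boldsymbol B-b\boldsymbol 1$ (strictly in every component), i.e. there is a measurable $\boldsymbol\pi=(\pi_a)_{a\in\mathcal A}$ from $\mathcal X$ to the probability distributions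 on $\mathcal A$ with $\mathbb E_{\boldsymbol X\sim\nu}\bigl[\sum_a\boldsymbol c(\boldsymbol X,a)\pi_a(\boldsymbol X)\bigr]\le\boldsymbol B'$. Then the function $$\boldsymbol\lambda\mapsto\mathbb E_{\boldsymbol X\sim\nu}\Bigl[\max_{a\in\mathcal A}\bigl\{r(\boldsymbol X,a)-\langle\boldsymbol c(\boldsymbol X,a)-(\boldsymbol B-b\boldsymbol 1),\boldsymbol\lambda\rangle\bigr\}\Bigr]$$ has a minimizer over $\boldsymbol\lambda\ge\boldsymbol 0$; and for every such minimizer $\boldsymbol\lambda^\star_{\boldsymbol B-b\boldsymbol 1}$, if the strategy is run with confidence parameter $\delta/4$, then with probability at least $1-\delta$, $$\forall\,1\le t\le T,\qquad\Bigl\|\Bigl(\sum_{\tau=1}^t\boldsymbol c_\tau-t(\boldsymbol B-b\boldsymbol 1)\Bigr)_+\Bigr\|\le\frac{1+3\|\boldsymbol\lambda^\star_{\boldsymbol B-b\boldsymbol 1}\|}{\gamma}+20\sqrt d\,\Upsilon_{T,\delta},$$ where $\Upsilon_{T,\delta}=\max\Bigl\{\beta_{T,\delta/4},\ 2\sqrt{dT\ln\frac{T^2}{\delta/4}},\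 \sqrt{2T\ln\frac{2(d+1)T}{\delta/4}}\Bigr\}$. -/

import Mathlib

open MeasureTheory ProbabilityTheory

universe u v w

noncomputable section

namespace CBwK

/-- The unknown part of a contextual bandit problem with knapsacks: a context distribution `ν`
on `X`, an expected-reward function with values in `[0,1]` and an expected-cost function with
values in `[-1,1]^d`. Vectors of `ℝ^d` are functions `Fin d → ℝ`, ordered pointwise. -/
structure Problem (X : Type v) (A : Type w) (d : ℕ) [MeasurableSpace X] where
  ν : Measure X
  isProbabilityMeasure : IsProbabilityMeasure ν
  reward : X → A → ℝ
  cost : X → A → Fin d → ℝ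
  measurable_reward : ∀ a, Measurable fun x => reward x a
  measurable_cost : ∀ a, Measurable fun x => cost x a
  reward_mem : ∀ x a, reward x a ∈ Set.Icc (0 : ℝ) 1
  cost_mem : ∀ x a, cost x a ∈ Set.Icc (-1 : Fin d → ℝ) 1

/-- The Euclidean norm on `ℝ^d`. -/
def euclNorm {d : ℕ} (v : Fin d → ℝ) : ℝ := ‖(WithLp.toLp 2 v : EuclideanSpace ℝ (Fin d))‖

/-- The vector `B - b·1`. -/
def withMargin {d : ℕ} (B : Fin d → ℝ) (b : ℝ) : Fin d → ℝ := fun i => B i - b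

/-- `S` holds with probability at least `p`: it contains an event of probability at least `p`. -/
def HoldsWithProb {Ω : Type u} [MeasurableSpace Ω] (P : Measure Ω) (p : ℝ) (S : Set Ω) : Prop :=
  ∃ E : Set Ω, MeasurableSet E ∧ E ⊆ S ∧ ENNReal.ofReal p ≤ P E

section Policies

variable {X : Type v} {A : Type w} {d : ℕ} [MeasurableSpace X] [Fintype A]

/-- A static policy, i.e. a (measurable) map from contexts to probability vectors on `A`. -/
def IsPolicy (π : X → A → ℝ) : Prop :=
  (∀ a, Measurable fun x => π x a) ∧ (∀ x a, 0 ≤ π x a) ∧ ∀ x, ∑ a, π x a = 1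

/-- Feasibility of the problem for the average cost constraints `B'`. -/
def Feasible (p : Problem X A d) (B' : Fin d → ℝ) : Prop :=
  ∃ π : X → A → ℝ, IsPolicy π ∧ ∀ i, ∫ x, ∑ a, p.cost x a i * π x a ∂p.ν ≤ B' i

/-- The dual objective
`λ ↦ 𝔼_{X ∼ ν} [ max_a { r(X,a) - ⟨c(X,a) - B, λ⟩ } ]` for the cost constraints `B`. -/
def dualObjective [Nonempty A] (p : Problem X A d) (B l : Fin d → ℝ) : ℝ :=
  ∫ x, Finset.univ.sup' Finset.univ_nonempty
    (fun a : A => p.reward x a - (p.cost x a - B) ⬝ᵥ l) ∂p.ν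

/-- `l` is an optimal dual variable `λ⋆_B`: it minimizes the dual objective over `λ ≥ 0`. -/
def IsDualOptimal [Nonempty A] (p : Problem X A d) (B l : Fin d → ℝ) : Prop :=
  0 ≤ l ∧ ∀ μ : Fin d → ℝ, 0 ≤ μ → dualObjective p B l ≤ dualObjective p B μ

end Policies

/-- What is observed in one round: context, action, reward, vector of costs. -/
abbrev Obs (X : Type v) (A : Type w) (d : ℕ) : Type (max v w) := X × A × ℝ × (Fin d → ℝ)

/-- An estimation procedure. At time `t` it maps the observations of rounds `1, …, t` (entry
`s : Fin t` being round `s + 1`) to estimates of the expected rewards and costs, and the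
context–action pairs of rounds `1, …, t` to an error function `ε_t(x, a, δ)`, `δ ∈ (0,1]`. -/
structure EstimationProcedure (X : Type v) (A : Type w) (d : ℕ)
    [MeasurableSpace X] [MeasurableSpace A] where
  rhat : (t : ℕ) → (Fin t → Obs X A d) → X → A → ℝ
  chat : (t : ℕ) → (Fin t → Obs X A d) → X → A → Fin d → ℝ
  err : (t : ℕ) → (Fin t → X × A) → X → A → ℝ → ℝ
  rhat_mem : ∀ t h x a, rhat t h x a ∈ Set.Icc (0 : ℝ) 1
  chat_mem : ∀ t h x a, chat t h x a ∈ Set.Icc (-1 : Fin d → ℝ) 1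
  err_mem : ∀ t h x a, ∀ δ ∈ Set.Ioc (0 : ℝ) 1, err t h x a δ ∈ Set.Icc (0 : ℝ) 1
  measurable_rhat : ∀ t a, Measurable fun q : (Fin t → Obs X A d) × X => rhat t q.1 q.2 a
  measurable_chat : ∀ t a, Measurable fun q : (Fin t → Obs X A d) × X => chat t q.1 q.2 a
  measurable_err : ∀ t a, ∀ δ ∈ Set.Ioc (0 : ℝ) 1,
    Measurable fun q : (Fin t → X × A) × X => err t q.1 q.2 a δ

/-- The random contexts, actions, rewards and costs; rounds are numbered from `1`
(the values at index `0` play no role). -/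
structure Interaction (Ω : Type u) (X : Type v) (A : Type w) (d : ℕ) where
  context : ℕ → Ω → X
  action : ℕ → Ω → A
  reward : ℕ → Ω → ℝ
  cost : ℕ → Ω → Fin d → ℝ

namespace Interaction

variable {Ω : Type u} {X : Type v} {A : Type w} {d : ℕ}

/-- The observations of rounds `1, …, t`. -/
def history (I : Interaction Ω X A d) (t : ℕ) (ω : Ω) : Fin t → Obs X A d :=
  fun s => (I.context (s + 1) ω, I.action (s + 1) ω, I.reward (s + 1) ω, I.cost (s + 1) ω)

/-- The context–action pairs of rounds `1, …, t`. -/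
def pairs (I : Interaction Ω X A d) (t : ℕ) (ω : Ω) : Fin t → X × A :=
  fun s => (I.context (s + 1) ω, I.action (s + 1) ω)

/-- The σ-algebra generated by the observations of rounds `1, …, t`, by the context of round
`t + 1` and by the action of round `t + 1`. -/
@[reducible] def info [MeasurableSpace X] [MeasurableSpace A] (I : Interaction Ω X A d) (t : ℕ) :
    MeasurableSpace Ω :=
  MeasurableSpace.comap (fun ω => (I.history t ω, I.context (t + 1) ω, I.action (t + 1) ω))
    inferInstance

/-- Rewards and costs of rounds `1, …, T` are generated as the problem `p` prescribes: they lie in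
`[0,1]` and `[-1,1]^d`, and given the past, the current context and the current action, their
conditional expectations are `r(x_t, a_t)` and `c(x_t, a_t)`. Nothing is said about how the
contexts and the actions are chosen. -/
structure Follows [MeasurableSpace Ω] [MeasurableSpace X] [MeasurableSpace A]
    (I : Interaction Ω X A d) (p : Problem X A d) (P : Measure Ω) (T : ℕ) : Prop where
  measurable_context : ∀ t < T, Measurable (I.context (t + 1))
  measurable_action : ∀ t < T, Measurable (I.action (t + 1))
  measurable_reward : ∀ t < T, Measurable (I.reward (t + 1))
  measurable_cost : ∀ t < T, Measurable (I.cost (t + 1))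
  reward_mem : ∀ t < T, ∀ ω, I.reward (t + 1) ω ∈ Set.Icc (0 : ℝ) 1
  cost_mem : ∀ t < T, ∀ ω, I.cost (t + 1) ω ∈ Set.Icc (-1 : Fin d → ℝ) 1
  condExp_reward : ∀ t < T, P[I.reward (t + 1) | I.info t] =ᵐ[P]
    fun ω => p.reward (I.context (t + 1) ω) (I.action (t + 1) ω)
  condExp_cost : ∀ t < T, ∀ i, P[fun ω => I.cost (t + 1) ω i | I.info t] =ᵐ[P]
    fun ω => p.cost (I.context (t + 1) ω) (I.action (t + 1) ω) i

/-- In each round `1, …, T` the context is drawn from `ν`, independently of the past. -/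
def ContextsDrawnFrom [MeasurableSpace Ω] [MeasurableSpace X] [MeasurableSpace A]
    (I : Interaction Ω X A d) (ν : Measure X) (P : Measure Ω) (T : ℕ) : Prop :=
  ∀ t < T, P.map (I.context (t + 1)) = ν ∧ IndepFun (I.history t) (I.context (t + 1)) P

end Interaction

namespace EstimationProcedure

variable {Ω : Type u} {X : Type v} {A : Type w} {d : ℕ} [MeasurableSpace X] [MeasurableSpace A]

/-- The sum `β_{T,δ} = ∑_{t=1}^T ε_{t-1}(x_t, a_t, δ)`. -/
def beta (E : EstimationProcedure X A d) (I : Interaction Ω X A d) (T : ℕ) (δ : ℝ) (ω : Ω) : ℝ :=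
  ∑ t ∈ Finset.range T, E.err t (I.pairs t ω) (I.context (t + 1) ω) (I.action (t + 1) ω) δ

/-- The estimation guarantee: however contexts and actions are picked, for every `δ ∈ (0,1]`, with
probability at least `1 - δ` the estimates at all times `0 ≤ t ≤ T` are within the error
functions of the true expected rewards and costs, uniformly over contexts and actions. -/
def IsAccurate (E : EstimationProcedure X A d) (p : Problem X A d) (T : ℕ) : Prop :=
  ∀ (Ω : Type u) [MeasurableSpace Ω] (P : Measure Ω) [IsProbabilityMeasure P]
    (I : Interaction Ω X A d), I.Follows p P T → ∀ δ ∈ Set.Ioc (0 : ℝ) 1,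
      HoldsWithProb P (1 - δ) {ω | ∀ t ≤ T, ∀ (x : X) (a : A),
        |E.rhat t (I.history t ω) x a - p.reward x a| ≤ E.err t (I.pairs t ω) x a δ ∧
        ∀ i, |E.chat t (I.history t ω) x a i - p.cost x a i| ≤ E.err t (I.pairs t ω) x a δ}

/-- Clipped upper confidence bound on the rewards after `t` rounds. -/
def rucb (E : EstimationProcedure X A d) (δ : ℝ) (I : Interaction Ω X A d) (t : ℕ) (ω : Ω)
    (x : X) (a : A) : ℝ :=
  min (max (E.rhat t (I.history t ω) x a + E.err t (I.pairs t ω) x a δ) 0) 1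

/-- Clipped lower confidence bound on the costs after `t` rounds. -/
def clcb (E : EstimationProcedure X A d) (δ : ℝ) (I : Interaction Ω X A d) (t : ℕ) (ω : Ω)
    (x : X) (a : A) : Fin d → ℝ :=
  fun i => min (max (E.chat t (I.history t ω) x a i - E.err t (I.pairs t ω) x a δ) (-1)) 1

/-- The dual variables `λ_0, λ_1, …` of projected gradient descent with step size `γ`. -/
def dualVar (E : EstimationProcedure X A d) (B : Fin d → ℝ) (b γ δ : ℝ)
    (I : Interaction Ω X A d) (ω : Ω) : ℕ → Fin d → ℝ
  | 0 => 0
  | t + 1 => (dualVar E B b γ δ I ω t + γ •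
      (E.clcb δ I t ω (I.context (t + 1) ω) (I.action (t + 1) ω) - withMargin B b))⁺

/-- The quantity maximized over `a` at round `t + 1`. -/
def score (E : EstimationProcedure X A d) (B : Fin d → ℝ) (b γ δ : ℝ)
    (I : Interaction Ω X A d) (t : ℕ) (ω : Ω) (a : A) : ℝ :=
  E.rucb δ I t ω (I.context (t + 1) ω) a -
    (E.clcb δ I t ω (I.context (t + 1) ω) a - withMargin B b) ⬝ᵥ E.dualVar B b γ δ I ω t

/-- The actions of rounds `1, …, T` are picked by the fixed-step-size projected-gradient-descent
strategy run with step size `γ`, margin `b` and confidence level `1 - δ`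
(ties may be broken in any way). -/
def PlayedBy (E : EstimationProcedure X A d) (B : Fin d → ℝ) (b γ δ : ℝ)
    (I : Interaction Ω X A d) (T : ℕ) : Prop :=
  ∀ t < T, ∀ ω a, E.score B b γ δ I t ω a ≤ E.score B b γ δ I t ω (I.action (t + 1) ω)

/-- The deviation term `Υ_{T,δ}`. -/
def upsilon (E : EstimationProcedure X A d) (I : Interaction Ω X A d) (T : ℕ) (δ : ℝ) (ω : Ω) :
    ℝ :=
  max (E.beta I T (δ / 4) ω)
    (max (2 * √(d * T * Real.log ((T : ℝ) ^ 2 / (δ / 4))))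
      √(2 * T * Real.log (2 * ((d : ℝ) + 1) * T / (δ / 4))))

end EstimationProcedure

end CBwK

end

/-! Existence of a dual minimizer: weak duality (`dotProduct_le_dualObjective`) makes the dual
objective grow linearly on the nonnegative orthant, so beyond an explicit box it exceeds its value
at 0; continuity on the box does the rest.

For the cost bound, the multipliers record the estimated overrun: up to the factor `γ⁻¹` they
dominate it, and true costs differ from estimated ones by estimation errors and martingale noise
(`euclNorm_posPart_sum_cost_le`). It remains to keep the multipliers near a dual optimum `l`. The
descent inequality bounds `‖λ_n - l‖²` by `‖l‖²`, plus `2γ` times the sum of `⟨g_s, λ_s - l⟩` over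
the gradients `g_s`, plus a quadratic term. Optimism (`roundCost_dotProduct_le`) bounds each product
by the gap between the Lagrangian maxima at `l` and at `λ_s`, evaluated at the fresh context, plus
an error. In expectation over the context this gap is nonpositive because `l` is optimal, so only
its centered part matters, and Azuma–Hoeffding controls that.

The obstacle is circular: the increments of that martingale are of size `√d ‖λ_s - l‖`, the very
quantity to be bounded. Truncating them at a deterministic level `D` (`truncGap`) keeps them
centered, since the truncation depends only on the past. A union bound over `T` levels spaced by
`2γ√d`, the largest possible move in one round, provides a level within one spacing above the
maximal distance along the path. At that level no truncation occurs before the maximum, and the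
descent inequality becomes a quadratic inequality in the maximal distance. -/

namespace CBwK

/-! ### Azuma–Hoeffding from orthogonality to exponentials -/

section Azuma

variable {Ω : Type u} [MeasurableSpace Ω]

/-- The chord of `exp (s * ·)` on `[-C, C]` lies above the graph. -/
theorem exp_mul_le_cosh_add_sinh {C x : ℝ} (hC : 0 < C) (hx : |x| ≤ C) (s : ℝ) :
    Real.exp (s * x) ≤ Real.cosh (s * C) + x * (Real.sinh (s * C) / C) := by
  obtain ⟨h1, h2⟩ := abs_le.mp hx
  have hw1 : 0 ≤ (C + x) / (2 * C) := div_nonneg (by linarith) (by linarith)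
  have hw2 : 0 ≤ (C - x) / (2 * C) := div_nonneg (by linarith) (by linarith)
  have hw : (C + x) / (2 * C) + (C - x) / (2 * C) = 1 := by field_simp; ring
  have h := convexOn_exp.2 (Set.mem_univ (s * C)) (Set.mem_univ (-(s * C))) hw1 hw2 hw
  have e1 : ((C + x) / (2 * C)) • (s * C) + ((C - x) / (2 * C)) • (-(s * C)) = s * x := by
    simp only [smul_eq_mul]; field_simp; ring
  rw [e1] at h
  refine h.trans (le_of_eq ?_)
  rw [Real.cosh_eq, Real.sinh_eq]
  simp only [smul_eq_mul]
  field_simp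
  ring

/-- A finite sum of bounded measurable functions has exponential moments of every order. -/
theorem integrable_exp_mul_sum {P : Measure Ω} [IsProbabilityMeasure P] {ξ : ℕ → Ω → ℝ} {n : ℕ}
    {C : ℝ} (hm : ∀ k < n, Measurable (ξ k)) (hb : ∀ k < n, ∀ ω, |ξ k ω| ≤ C) (s : ℝ) :
    Integrable (fun ω => Real.exp (s * ∑ k ∈ Finset.range n, ξ k ω)) P := by
  refine Integrable.of_bound (C := Real.exp (|s| * (n * C))) ?_ (ae_of_all _ fun ω => ?_)
  · refine (Measurable.exp ?_).aestronglyMeasurable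
    exact (Finset.measurable_sum _ fun k hk => hm k (Finset.mem_range.mp hk)).const_mul s
  · rw [Real.norm_eq_abs, abs_of_pos (Real.exp_pos _), Real.exp_le_exp]
    refine (le_abs_self _).trans ?_
    rw [abs_mul]
    refine mul_le_mul_of_nonneg_left ?_ (abs_nonneg s)
    refine (Finset.abs_sum_le_sum_abs _ _).trans ?_
    refine (Finset.sum_le_sum fun k hk => hb k (Finset.mem_range.mp hk) ω).trans ?_
    simp

/-- Replacing the last exponential factor by its chord leaves a constant, which multiplies the
previous moment, and a linear term, which orthogonality kills. -/
theorem integral_exp_mul_sum_le {P : Measure Ω} [IsProbabilityMeasure P] {ξ : ℕ → Ω → ℝ} {n : ℕ}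
    {C : ℝ} (hC : 0 < C) (hm : ∀ k < n, Measurable (ξ k)) (hb : ∀ k < n, ∀ ω, |ξ k ω| ≤ C) (s : ℝ)
    (horth : ∀ k < n, ∫ ω, Real.exp (s * ∑ j ∈ Finset.range k, ξ j ω) * ξ k ω ∂P = 0) :
    ∫ ω, Real.exp (s * ∑ k ∈ Finset.range n, ξ k ω) ∂P ≤ Real.cosh (s * C) ^ n := by
  induction n with
  | zero => simp
  | succ n ih =>
    have ih' := ih (fun k hk => hm k (by omega)) (fun k hk => hb k (by omega))
      (fun k hk => horth k (by omega))
    have hint := integrable_exp_mul_sum (P := P) (n := n) (fun k hk => hm k (by omega))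
      (fun k hk => hb k (by omega)) s
    have hint' : Integrable
        (fun ω => Real.exp (s * ∑ j ∈ Finset.range n, ξ j ω) * ξ n ω) P :=
      hint.mul_bdd (c := C) (hm n (by omega)).aestronglyMeasurable
        (ae_of_all _ fun ω => by simpa using hb n (by omega) ω)
    calc ∫ ω, Real.exp (s * ∑ k ∈ Finset.range (n + 1), ξ k ω) ∂P
        ≤ ∫ ω, (Real.cosh (s * C) * Real.exp (s * ∑ k ∈ Finset.range n, ξ k ω)
            + (Real.sinh (s * C) / C) *
              (Real.exp (s * ∑ j ∈ Finset.range n, ξ j ω) * ξ n ω)) ∂P := by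
          refine integral_mono (integrable_exp_mul_sum hm hb s)
            ((hint.const_mul _).add (hint'.const_mul _)) fun ω => ?_
          simp only [Finset.sum_range_succ, mul_add, Real.exp_add]
          have := mul_le_mul_of_nonneg_left
            (exp_mul_le_cosh_add_sinh hC (hb n (by omega) ω) s)
            (Real.exp_pos (s * ∑ k ∈ Finset.range n, ξ k ω)).le
          refine this.trans (le_of_eq (by ring))
      _ = Real.cosh (s * C) * ∫ ω, Real.exp (s * ∑ k ∈ Finset.range n, ξ k ω) ∂P := by
          rw [integral_add (hint.const_mul _) (hint'.const_mul _), integral_const_mul,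
            integral_const_mul, horth n (by omega), mul_zero, add_zero]
      _ ≤ Real.cosh (s * C) ^ (n + 1) := by
          rw [pow_succ, mul_comm]
          exact mul_le_mul_of_nonneg_right ih' (Real.cosh_pos _).le

/-- **Azuma–Hoeffding inequality**, with the martingale property replaced by the orthogonality of
each increment to the exponentials of the past sums. -/
theorem measureReal_sum_ge_le_exp_neg {P : Measure Ω} [IsProbabilityMeasure P] {ξ : ℕ → Ω → ℝ}
    {n T : ℕ} (hnT : n ≤ T) (hT : 0 < T) {C : ℝ} (hC : 0 < C) (hm : ∀ k < n, Measurable (ξ k))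
    (hb : ∀ k < n, ∀ ω, |ξ k ω| ≤ C)
    (horth : ∀ s : ℝ, ∀ k < n, ∫ ω, Real.exp (s * ∑ j ∈ Finset.range k, ξ j ω) * ξ k ω ∂P = 0)
    {L : ℝ} (hL : 0 ≤ L) :
    P.real {ω | C * √(2 * T * L) ≤ ∑ k ∈ Finset.range n, ξ k ω} ≤ Real.exp (-L) := by
  have hT' : (0 : ℝ) < T := by exact_mod_cast hT
  set R := √(2 * T * L) with hR
  have hR2 : R ^ 2 = 2 * T * L := Real.sq_sqrt (by positivity)
  have hR0 : 0 ≤ R := Real.sqrt_nonneg _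
  -- The Chernoff-optimal parameter: the threshold contributes `-2 * L` to the exponent and the
  -- moment bound at most `L`.
  set s := R / (T * C) with hs
  have hs0 : 0 ≤ s := by positivity
  refine (measure_ge_le_exp_mul_mgf (C * R) hs0 (integrable_exp_mul_sum hm hb s)).trans ?_
  have h1 : mgf (fun ω => ∑ k ∈ Finset.range n, ξ k ω) P s ≤ Real.exp L := by
    refine (integral_exp_mul_sum_le hC hm hb s (horth s)).trans ?_
    calc Real.cosh (s * C) ^ n ≤ Real.exp ((s * C) ^ 2 / 2) ^ n :=
          pow_le_pow_left₀ (Real.cosh_pos _).le (Real.cosh_le_exp_half_sq _) n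
      _ ≤ Real.exp ((s * C) ^ 2 / 2) ^ T :=
          pow_le_pow_right₀ (Real.one_le_exp (by positivity)) hnT
      _ = Real.exp L := by
          rw [← Real.exp_nat_mul]
          congr 1
          have : s * C = R / T := by rw [hs]; field_simp
          rw [this, div_pow, hR2]; field_simp
  calc Real.exp (-s * (C * R)) * _ ≤ Real.exp (-s * (C * R)) * Real.exp L :=
        mul_le_mul_of_nonneg_left h1 (Real.exp_pos _).le
    _ = Real.exp (-L) := by
        rw [← Real.exp_add]
        congr 1
        have : s * (C * R) = 2 * L := by
          rw [hs]
          have : R / (T * C) * (C * R) = R ^ 2 / T := by field_simp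
          rw [this, hR2]; field_simp
        linarith [this, neg_mul s (C * R)]

end Azuma

/-! ### Euclidean norm and projected gradient steps -/

section EuclNorm

variable {d : ℕ}

theorem euclNorm_eq (v : Fin d → ℝ) : euclNorm v = √(∑ i, v i ^ 2) := by
  simp [euclNorm, EuclideanSpace.norm_eq]

theorem euclNorm_sq (v : Fin d → ℝ) : euclNorm v ^ 2 = ∑ i, v i ^ 2 := by
  rw [euclNorm_eq, Real.sq_sqrt (Finset.sum_nonneg fun i _ => sq_nonneg _)]

theorem euclNorm_nonneg (v : Fin d → ℝ) : 0 ≤ euclNorm v := norm_nonneg _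

theorem euclNorm_add_le (v w : Fin d → ℝ) : euclNorm (v + w) ≤ euclNorm v + euclNorm w :=
  norm_add_le _ _

theorem euclNorm_smul (c : ℝ) (v : Fin d → ℝ) : euclNorm (c • v) = |c| * euclNorm v :=
  norm_smul c (WithLp.toLp 2 v : EuclideanSpace ℝ (Fin d))

theorem euclNorm_neg (v : Fin d → ℝ) : euclNorm (-v) = euclNorm v :=
  norm_neg (WithLp.toLp 2 v : EuclideanSpace ℝ (Fin d))

theorem continuous_euclNorm : Continuous (euclNorm : (Fin d → ℝ) → ℝ) := by
  simp only [funext euclNorm_eq]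
  fun_prop

theorem euclNorm_le_of_abs_le {v w : Fin d → ℝ} (h : ∀ i, |v i| ≤ |w i|) :
    euclNorm v ≤ euclNorm w := by
  rw [euclNorm_eq, euclNorm_eq]
  exact Real.sqrt_le_sqrt (Finset.sum_le_sum fun i _ => sq_le_sq.mpr (h i))

theorem euclNorm_const (c : ℝ) : euclNorm (fun _ : Fin d => c) = √d * |c| := by
  rw [euclNorm_eq]
  simp [Real.sqrt_sq_eq_abs]

theorem euclNorm_le_of_forall_abs_le {v : Fin d → ℝ} {c : ℝ} (h : ∀ i, |v i| ≤ c) :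
    euclNorm v ≤ √d * |c| := by
  rw [← euclNorm_const]
  exact euclNorm_le_of_abs_le fun i => (h i).trans (le_abs_self c)

theorem abs_dotProduct_le (v w : Fin d → ℝ) : |v ⬝ᵥ w| ≤ euclNorm v * euclNorm w := by
  rw [← Real.sqrt_sq_eq_abs, euclNorm_eq, euclNorm_eq, ← Real.sqrt_mul
    (Finset.sum_nonneg fun i _ => sq_nonneg _)]
  exact Real.sqrt_le_sqrt (Finset.sum_mul_sq_le_sq_mul_sq _ _ _)

theorem sum_le_sqrt_mul_euclNorm (v : Fin d → ℝ) : ∑ i, v i ≤ √d * euclNorm v := by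
  have h := (le_abs_self _).trans (abs_dotProduct_le (fun _ : Fin d => (1 : ℝ)) v)
  rw [euclNorm_const] at h
  simpa [dotProduct] using h

theorem euclNorm_posPart_sub_le {l : Fin d → ℝ} (hl : 0 ≤ l) (v : Fin d → ℝ) :
    euclNorm (v⁺ - l) ≤ euclNorm (v - l) := by
  refine euclNorm_le_of_abs_le fun i => ?_
  have hli : 0 ≤ l i := hl i
  simp only [Pi.sub_apply, Pi.posPart_apply]
  rcases le_total 0 (v i) with h | h
  · rw [posPart_of_nonneg h]
  · rw [posPart_of_nonpos h, zero_sub, abs_neg, abs_of_nonneg hli, abs_of_nonpos (by linarith)]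
    linarith

/-- One step of projected gradient descent. -/
theorem euclNorm_posPart_step_sq_le {l : Fin d → ℝ} (hl : 0 ≤ l) (m g : Fin d → ℝ) (γ : ℝ) :
    euclNorm ((m + γ • g)⁺ - l) ^ 2 ≤
      euclNorm (m - l) ^ 2 + 2 * γ * (g ⬝ᵥ (m - l)) + γ ^ 2 * euclNorm g ^ 2 := by
  refine (pow_le_pow_left₀ (euclNorm_nonneg _) (euclNorm_posPart_sub_le hl _) 2).trans
    (le_of_eq ?_)
  simp only [euclNorm_sq, dotProduct, Finset.mul_sum, ← Finset.sum_add_distrib, Pi.sub_apply,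
    Pi.add_apply, Pi.smul_apply, smul_eq_mul]
  exact Finset.sum_congr rfl fun i _ => by ring

end EuclNorm

/-! ### The dual objective: regularity, weak duality, minimizers, truncated gaps -/

section Dual

variable {X : Type v} {A : Type w} {d : ℕ} [MeasurableSpace X] [Fintype A] [Nonempty A]

/-- The integrand `max_a { r(x,a) - ⟨c(x,a) - B, l⟩ }` of the dual objective. -/
noncomputable def lagrangianMax (p : Problem X A d) (B l : Fin d → ℝ) (x : X) : ℝ :=
  Finset.univ.sup' Finset.univ_nonempty (fun a : A => p.reward x a - (p.cost x a - B) ⬝ᵥ l)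

theorem le_lagrangianMax (p : Problem X A d) (B l : Fin d → ℝ) (x : X) (a : A) :
    p.reward x a - (p.cost x a - B) ⬝ᵥ l ≤ lagrangianMax p B l x :=
  Finset.le_sup' (fun a : A => p.reward x a - (p.cost x a - B) ⬝ᵥ l) (Finset.mem_univ a)

theorem lagrangianMax_le {p : Problem X A d} {B l : Fin d → ℝ} {x : X} {z : ℝ}
    (h : ∀ a, p.reward x a - (p.cost x a - B) ⬝ᵥ l ≤ z) : lagrangianMax p B l x ≤ z :=
  Finset.sup'_le _ _ fun a _ => h a

theorem dualObjective_eq (p : Problem X A d) (B l : Fin d → ℝ) :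
    dualObjective p B l = ∫ x, lagrangianMax p B l x ∂p.ν := rfl

theorem abs_sub_le_two {x y : ℝ} (hx : x ∈ Set.Icc (-1 : ℝ) 1) (hy : y ∈ Set.Icc (0 : ℝ) 1) :
    |x - y| ≤ 2 := by
  rw [abs_le]
  constructor <;> linarith [hx.1, hx.2, hy.1, hy.2]

theorem euclNorm_sub_le_two_mul_sqrt {c B : Fin d → ℝ} (hc : c ∈ Set.Icc (-1 : Fin d → ℝ) 1)
    (hB : B ∈ Set.Icc (0 : Fin d → ℝ) 1) : euclNorm (c - B) ≤ 2 * √d := by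
  refine (euclNorm_le_of_forall_abs_le (c := 2) fun i =>
    abs_sub_le_two ⟨hc.1 i, hc.2 i⟩ ⟨hB.1 i, hB.2 i⟩).trans (le_of_eq ?_)
  rw [abs_of_pos two_pos, mul_comm]

/-- Each of the affine functions under the maximum has slope of norm at most `2 * √d`, and a maximum
inherits the Lipschitz constant. -/
theorem lagrangianMax_sub_le (p : Problem X A d) {B : Fin d → ℝ}
    (hB : B ∈ Set.Icc (0 : Fin d → ℝ) 1) (l m : Fin d → ℝ) (x : X) :
    lagrangianMax p B l x - lagrangianMax p B m x ≤ 2 * √d * euclNorm (m - l) := by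
  rw [sub_le_iff_le_add]
  refine lagrangianMax_le fun a => ?_
  have h1 := le_lagrangianMax p B m x a
  have h2 : (p.cost x a - B) ⬝ᵥ (m - l) ≤ 2 * √d * euclNorm (m - l) :=
    ((le_abs_self _).trans (abs_dotProduct_le _ _)).trans
      (mul_le_mul_of_nonneg_right (euclNorm_sub_le_two_mul_sqrt (p.cost_mem x a) hB)
        (euclNorm_nonneg _))
  rw [dotProduct_sub] at h2
  linarith

theorem abs_lagrangianMax_sub_le (p : Problem X A d) {B : Fin d → ℝ}
    (hB : B ∈ Set.Icc (0 : Fin d → ℝ) 1) (l m : Fin d → ℝ) (x : X) :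
    |lagrangianMax p B l x - lagrangianMax p B m x| ≤ 2 * √d * euclNorm (m - l) := by
  refine abs_le.mpr ⟨?_, lagrangianMax_sub_le p hB l m x⟩
  have h := lagrangianMax_sub_le p hB m l x
  rw [← neg_sub m l, euclNorm_neg] at h
  linarith

/-- Joint measurability is needed because the multiplier plugged in later is itself random. -/
theorem measurable_uncurry_lagrangianMax (p : Problem X A d) (B : Fin d → ℝ) :
    Measurable fun q : (Fin d → ℝ) × X => lagrangianMax p B q.1 q.2 := by
  have h : (fun q : (Fin d → ℝ) × X => lagrangianMax p B q.1 q.2) =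
      Finset.univ.sup' Finset.univ_nonempty (fun (a : A) (q : (Fin d → ℝ) × X) =>
        p.reward q.2 a - (p.cost q.2 a - B) ⬝ᵥ q.1) := by
    ext q
    rw [Finset.sup'_apply]
    rfl
  rw [h]
  refine Finset.measurable_sup' _ fun a _ => ?_
  refine ((p.measurable_reward a).comp measurable_snd).sub ?_
  simp only [dotProduct]
  refine Finset.measurable_sum _ fun i _ => ?_
  have hc : Measurable fun q : (Fin d → ℝ) × X => p.cost q.2 a i :=
    (measurable_pi_iff.mp (p.measurable_cost a) i).comp measurable_snd
  exact (hc.sub_const _).mul ((measurable_pi_apply i).comp measurable_fst)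

theorem measurable_lagrangianMax (p : Problem X A d) (B l : Fin d → ℝ) :
    Measurable (lagrangianMax p B l) :=
  (measurable_uncurry_lagrangianMax p B).comp measurable_prodMk_left

theorem lagrangianMax_zero_mem (p : Problem X A d) (B : Fin d → ℝ) (x : X) :
    lagrangianMax p B 0 x ∈ Set.Icc (0 : ℝ) 1 := by
  refine ⟨?_, lagrangianMax_le fun a => by simpa using (p.reward_mem x a).2⟩
  obtain ⟨a⟩ := ‹Nonempty A›
  have h := le_lagrangianMax p B 0 x a
  simp only [dotProduct_zero, sub_zero] at h
  exact (p.reward_mem x a).1.trans h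

theorem abs_lagrangianMax_le (p : Problem X A d) {B : Fin d → ℝ}
    (hB : B ∈ Set.Icc (0 : Fin d → ℝ) 1) (l : Fin d → ℝ) (x : X) :
    |lagrangianMax p B l x| ≤ 1 + 2 * √d * euclNorm l := by
  have h1 := abs_lagrangianMax_sub_le p hB 0 l x
  rw [sub_zero] at h1
  obtain ⟨h2, h3⟩ := lagrangianMax_zero_mem p B x
  rw [abs_le] at h1 ⊢
  constructor <;> linarith [h1.1, h1.2]

theorem integrable_lagrangianMax (p : Problem X A d) {B : Fin d → ℝ}
    (hB : B ∈ Set.Icc (0 : Fin d → ℝ) 1) (l : Fin d → ℝ) :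
    Integrable (lagrangianMax p B l) p.ν := by
  have := p.isProbabilityMeasure
  exact Integrable.of_bound (measurable_lagrangianMax p B l).aestronglyMeasurable _
    (ae_of_all _ fun x => by simpa using abs_lagrangianMax_le p hB l x)

theorem abs_dualObjective_sub_le (p : Problem X A d) {B : Fin d → ℝ}
    (hB : B ∈ Set.Icc (0 : Fin d → ℝ) 1) (l m : Fin d → ℝ) :
    |dualObjective p B l - dualObjective p B m| ≤ 2 * √d * euclNorm (m - l) := by
  have := p.isProbabilityMeasure
  rw [dualObjective_eq, dualObjective_eq, ← integral_sub (integrable_lagrangianMax p hB l)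
    (integrable_lagrangianMax p hB m), ← Real.norm_eq_abs]
  have h := norm_integral_le_of_norm_le_const (μ := p.ν) (C := 2 * √d * euclNorm (m - l))
    (f := fun x => lagrangianMax p B l x - lagrangianMax p B m x)
    (ae_of_all _ fun x => by simpa using abs_lagrangianMax_sub_le p hB l m x)
  simpa using h

theorem continuous_dualObjective (p : Problem X A d) {B : Fin d → ℝ}
    (hB : B ∈ Set.Icc (0 : Fin d → ℝ) 1) : Continuous (dualObjective p B) := by
  rw [continuous_iff_continuousAt]
  intro m
  rw [ContinuousAt, tendsto_iff_dist_tendsto_zero]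
  refine squeeze_zero (fun _ => dist_nonneg)
    (fun l => (Real.dist_eq _ _).trans_le (abs_dualObjective_sub_le p hB l m)) ?_
  have h : Continuous fun l : Fin d → ℝ => 2 * √(d : ℝ) * euclNorm (m - l) :=
    continuous_const.mul (continuous_euclNorm.comp (continuous_const.sub continuous_id))
  simpa [euclNorm_eq] using h.tendsto m

/-- Weak duality: a feasible policy bounds the dual objective from below. -/
theorem dotProduct_le_dualObjective (p : Problem X A d) {B B' l : Fin d → ℝ}
    (hB : B ∈ Set.Icc (0 : Fin d → ℝ) 1) (hfeas : Feasible p B') (hl : 0 ≤ l) :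
    (B - B') ⬝ᵥ l ≤ dualObjective p B l := by
  have := p.isProbabilityMeasure
  obtain ⟨π, ⟨hπm, hπ0, hπ1⟩, hπ⟩ := hfeas
  set f : Fin d → X → ℝ := fun i x => ∑ a, p.cost x a i * π x a with hf
  have hfm : ∀ i, Measurable (f i) := fun i => Finset.measurable_sum _ fun a _ =>
    (measurable_pi_iff.mp (p.measurable_cost a) i).mul (hπm a)
  have hfb : ∀ i x, |f i x| ≤ 1 := by
    intro i x
    calc |f i x| ≤ ∑ a, |p.cost x a i * π x a| := Finset.abs_sum_le_sum_abs _ _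
      _ ≤ ∑ a, π x a := Finset.sum_le_sum fun a _ => by
          rw [abs_mul, abs_of_nonneg (hπ0 x a)]
          exact mul_le_of_le_one_left (hπ0 x a)
            (abs_le.mpr ⟨(p.cost_mem x a).1 i, (p.cost_mem x a).2 i⟩)
      _ = 1 := hπ1 x
  have hfi : ∀ i, Integrable (f i) p.ν := fun i =>
    Integrable.of_bound (hfm i).aestronglyMeasurable 1
      (ae_of_all _ fun x => by simpa using hfb i x)
  have hpt : ∀ x, ∑ i, (B i - f i x) * l i ≤ lagrangianMax p B l x := by
    intro x
    -- Averaging over the policy: rewards are nonnegative and may be dropped, and an average is at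
    -- most the maximum.
    calc ∑ i, (B i - f i x) * l i = ∑ a, π x a * (-((p.cost x a - B) ⬝ᵥ l)) := by
          simp only [dotProduct, hf, Pi.sub_apply, Finset.mul_sum, ← Finset.sum_neg_distrib]
          rw [Finset.sum_comm]
          refine Finset.sum_congr rfl fun i _ => ?_
          have : B i = ∑ a, B i * π x a := by rw [← Finset.mul_sum, hπ1, mul_one]
          conv_lhs => rw [this]
          rw [← Finset.sum_sub_distrib, Finset.sum_mul]
          exact Finset.sum_congr rfl fun a _ => by ring
      _ ≤ ∑ a, π x a * lagrangianMax p B l x := Finset.sum_le_sum fun a _ =>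
          mul_le_mul_of_nonneg_left
            (by linarith [le_lagrangianMax p B l x a, (p.reward_mem x a).1]) (hπ0 x a)
      _ = lagrangianMax p B l x := by rw [← Finset.sum_mul, hπ1, one_mul]
  have hint : ∀ i, Integrable (fun x => (B i - f i x) * l i) p.ν := fun i =>
    ((integrable_const _).sub (hfi i)).mul_const _
  calc (B - B') ⬝ᵥ l ≤ ∑ i, ∫ x, (B i - f i x) * l i ∂p.ν := by
        refine Finset.sum_le_sum fun i _ => ?_
        rw [integral_mul_const, integral_sub (integrable_const _) (hfi i)]
        refine mul_le_mul_of_nonneg_right ?_ (hl i)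
        have h : ∫ x, f i x ∂p.ν ≤ B' i := hπ i
        simp only [Pi.sub_apply, integral_const, probReal_univ, one_smul]
        linarith
    _ = ∫ x, ∑ i, (B i - f i x) * l i ∂p.ν := (integral_finsetSum _ fun i _ => hint i).symm
    _ ≤ dualObjective p B l :=
        integral_mono (integrable_finsetSum _ fun i _ => hint i)
          (integrable_lagrangianMax p hB l) hpt

/-- Under strict feasibility the dual objective has a minimizer over the nonnegative orthant. -/
theorem exists_isDualOptimal (p : Problem X A d) {B B' : Fin d → ℝ}
    (hB : B ∈ Set.Icc (0 : Fin d → ℝ) 1) (hB' : ∀ i, B' i < B i) (hfeas : Feasible p B') :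
    ∃ l, IsDualOptimal p B l := by
  have := p.isProbabilityMeasure
  -- Past `R i` in coordinate `i`, weak duality alone pushes the objective above 1, an upper bound
  -- for its value at 0.
  set R : Fin d → ℝ := fun i => 1 / (B i - B' i) with hR
  have hR0 : 0 ≤ R := fun i => (div_pos one_pos (sub_pos.mpr (hB' i))).le
  obtain ⟨l, hl, hmin⟩ := (isCompact_Icc (a := (0 : Fin d → ℝ)) (b := R)).exists_isMinOn
    ⟨0, le_rfl, hR0⟩ (continuous_dualObjective p hB).continuousOn
  refine ⟨l, hl.1, fun m hm => ?_⟩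
  by_cases hmR : m ≤ R
  · exact hmin ⟨hm, hmR⟩
  · obtain ⟨i, hi⟩ : ∃ i, R i < m i := by
      simpa [Pi.le_def] using hmR
    have h0 : dualObjective p B l ≤ dualObjective p B 0 := hmin ⟨le_rfl, hR0⟩
    have h1 : dualObjective p B 0 ≤ 1 := by
      have h := integral_mono (integrable_lagrangianMax p hB 0) (integrable_const (1 : ℝ))
        fun x => (lagrangianMax_zero_mem p B x).2
      rw [dualObjective_eq]
      simpa using h
    have h2 := dotProduct_le_dualObjective p hB hfeas hm
    have h3 : (B i - B' i) * m i ≤ (B - B') ⬝ᵥ m :=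
      Finset.single_le_sum (f := fun j => (B - B') j * m j)
        (fun j _ => mul_nonneg (sub_pos.mpr (hB' j)).le (hm j)) (Finset.mem_univ i)
    have h4 : 1 < (B i - B' i) * m i := by
      rw [hR] at hi
      rwa [div_lt_iff₀ (sub_pos.mpr (hB' i)), mul_comm] at hi
    linarith

/-- The centered difference of the dual integrands at `l` and `m`, truncated to `‖m - l‖ ≤ D`. -/
noncomputable def truncGap (p : Problem X A d) (B l : Fin d → ℝ) (D : ℝ) (m : Fin d → ℝ) (x : X) :
    ℝ :=
  open Classical in
  if euclNorm (m - l) ≤ D then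
    lagrangianMax p B l x - lagrangianMax p B m x - (dualObjective p B l - dualObjective p B m)
  else 0

theorem measurable_truncGap (p : Problem X A d) {B : Fin d → ℝ}
    (hB : B ∈ Set.Icc (0 : Fin d → ℝ) 1) (l : Fin d → ℝ) (D : ℝ) :
    Measurable fun q : (Fin d → ℝ) × X => truncGap p B l D q.1 q.2 := by
  refine Measurable.ite ?_ ?_ measurable_const
  · exact measurableSet_le (continuous_euclNorm.measurable.comp (measurable_fst.sub_const l))
      measurable_const
  · refine Measurable.sub ?_ ?_
    · exact ((measurable_lagrangianMax p B l).comp measurable_snd).sub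
        (measurable_uncurry_lagrangianMax p B)
    · exact measurable_const.sub
        ((continuous_dualObjective p hB).measurable.comp measurable_fst)

theorem abs_truncGap_le (p : Problem X A d) {B : Fin d → ℝ}
    (hB : B ∈ Set.Icc (0 : Fin d → ℝ) 1) (l : Fin d → ℝ) {D : ℝ} (hD : 0 ≤ D) (m : Fin d → ℝ)
    (x : X) : |truncGap p B l D m x| ≤ 4 * √d * D := by
  rw [truncGap]
  split_ifs with h
  · have h1 := abs_lagrangianMax_sub_le p hB l m x
    have h2 := abs_dualObjective_sub_le p hB l m
    have h3 : 2 * √(d : ℝ) * euclNorm (m - l) ≤ 2 * √d * D :=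
      mul_le_mul_of_nonneg_left h (by positivity)
    exact (abs_sub _ _).trans (by linarith)
  · rw [abs_zero]; positivity

/-- The truncation condition involves `m` only, not the context, so it does not spoil the centering.
-/
theorem integral_truncGap (p : Problem X A d) {B : Fin d → ℝ}
    (hB : B ∈ Set.Icc (0 : Fin d → ℝ) 1) (l : Fin d → ℝ) (D : ℝ) (m : Fin d → ℝ) :
    ∫ x, truncGap p B l D m x ∂p.ν = 0 := by
  have := p.isProbabilityMeasure
  by_cases h : euclNorm (m - l) ≤ D
  · simp only [truncGap, if_pos h]
    have hl := integrable_lagrangianMax p hB l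
    have hm := integrable_lagrangianMax p hB m
    have hlm : Integrable (fun x => lagrangianMax p B l x - lagrangianMax p B m x) p.ν := hl.sub hm
    rw [integral_sub hlm (integrable_const _), integral_sub hl hm,
      ← dualObjective_eq, ← dualObjective_eq]
    simp
  · simp [truncGap, if_neg h]

end Dual

/-! ### Measurability with respect to the history -/

section Measurability

variable {Ω : Type u} {X : Type v} {A : Type w} {d : ℕ} [MeasurableSpace Ω] [MeasurableSpace X]
  [MeasurableSpace A] {I : Interaction Ω X A d} {t : ℕ}

namespace Interaction

theorem measurable_obs_of_history (h : Measurable (I.history t)) {s : ℕ} (hs : s < t) :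
    Measurable fun ω => (I.context (s + 1) ω, I.action (s + 1) ω, I.reward (s + 1) ω,
      I.cost (s + 1) ω) :=
  measurable_pi_iff.mp h ⟨s, hs⟩

theorem measurable_history_of_le (h : Measurable (I.history t)) {s : ℕ} (hs : s ≤ t) :
    Measurable (I.history s) :=
  measurable_pi_iff.mpr fun j => measurable_obs_of_history h (j.2.trans_le hs)

theorem measurable_context_of_history (h : Measurable (I.history t)) {s : ℕ} (hs : s < t) :
    Measurable (I.context (s + 1)) :=
  (measurable_obs_of_history h hs).fst

theorem measurable_action_of_history (h : Measurable (I.history t)) {s : ℕ} (hs : s < t) :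
    Measurable (I.action (s + 1)) :=
  (measurable_obs_of_history h hs).snd.fst

theorem measurable_cost_of_history (h : Measurable (I.history t)) {s : ℕ} (hs : s < t) :
    Measurable (I.cost (s + 1)) :=
  (measurable_obs_of_history h hs).snd.snd.snd

theorem measurable_pairs_of_history (h : Measurable (I.history t)) : Measurable (I.pairs t) :=
  measurable_pi_iff.mpr fun j =>
    (measurable_context_of_history h j.2).prodMk (measurable_action_of_history h j.2)

theorem Follows.measurable_history {p : Problem X A d} {P : Measure Ω} {T : ℕ}
    (hI : I.Follows p P T) (ht : t ≤ T) : Measurable (I.history t) :=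
  measurable_pi_iff.mpr fun j =>
    have hj : (j : ℕ) < T := j.2.trans_le ht
    (hI.measurable_context j hj).prodMk ((hI.measurable_action j hj).prodMk
      ((hI.measurable_reward j hj).prodMk (hI.measurable_cost j hj)))

end Interaction

variable [Fintype A] [MeasurableSingletonClass A]

theorem Problem.measurable_cost_comp (p : Problem X A d) {x : Ω → X} {a : Ω → A}
    (hx : Measurable x) (ha : Measurable a) (i : Fin d) :
    Measurable fun ω => p.cost (x ω) (a ω) i := by
  have h : Measurable fun q : X × A => p.cost q.1 q.2 i :=
    measurable_from_prod_countable_left fun a => measurable_pi_iff.mp (p.measurable_cost a) i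
  exact h.comp (hx.prodMk ha)

theorem EstimationProcedure.measurable_clcb (E : EstimationProcedure X A d) {δ : ℝ}
    (hδ : δ ∈ Set.Ioc (0 : ℝ) 1) (h : Measurable (I.history t)) {x : Ω → X} {a : Ω → A}
    (hx : Measurable x) (ha : Measurable a) :
    Measurable fun ω => E.clcb δ I t ω (x ω) (a ω) := by
  have hc : Measurable fun q : ((Fin t → Obs X A d) × X) × A => E.chat t q.1.1 q.1.2 q.2 :=
    measurable_from_prod_countable_left fun a => E.measurable_chat t a
  have he : Measurable fun q : ((Fin t → X × A) × X) × A => E.err t q.1.1 q.1.2 q.2 δ :=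
    measurable_from_prod_countable_left fun a => E.measurable_err t a δ hδ
  have hc' := hc.comp ((h.prodMk hx).prodMk ha)
  have he' := he.comp (((Interaction.measurable_pairs_of_history h).prodMk hx).prodMk ha)
  refine measurable_pi_iff.mpr fun i => ?_
  exact (((measurable_pi_iff.mp hc' i).sub he').max measurable_const).min measurable_const

/-- The σ-algebra on `Ω` is arbitrary as long as the history is measurable; taking the one generated
by the history shows that the multipliers are functions of the past. -/
theorem EstimationProcedure.measurable_dualVar (E : EstimationProcedure X A d) (B : Fin d → ℝ)
    (b γ : ℝ) {δ : ℝ} (hδ : δ ∈ Set.Ioc (0 : ℝ) 1) (h : Measurable (I.history t)) :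
    Measurable fun ω => E.dualVar B b γ δ I ω t := by
  induction t with
  | zero => exact measurable_const
  | succ t ih =>
    have h' := Interaction.measurable_history_of_le h t.le_succ
    have hg := E.measurable_clcb hδ h' (Interaction.measurable_context_of_history h t.lt_succ_self)
      (Interaction.measurable_action_of_history h t.lt_succ_self)
    have hs := (ih h').add ((hg.sub_const (withMargin B b)).const_smul γ)
    refine measurable_pi_iff.mpr fun i => ?_
    exact (measurable_pi_iff.mp hs i).sup_const 0

end Measurability

/-! ### Two sources of orthogonality: fresh samples and conditional expectations -/

section Orthogonality

variable {Ω : Type u} [MeasurableSpace Ω] {P : Measure Ω} [IsProbabilityMeasure P]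

/-- A function of an independent fresh sample, centered given the past, is orthogonal to the
past. -/
theorem integral_mul_eq_zero_of_indepFun {β : Type*} {X : Type v} [MeasurableSpace β]
    [MeasurableSpace X] {Y : Ω → β} {x : Ω → X} (hY : Measurable Y) (hx : Measurable x)
    (hind : IndepFun Y x P) {f : β × X → ℝ} (hf : Measurable f) {C : ℝ} (hC : ∀ q, |f q| ≤ C)
    (hf0 : ∀ y, ∫ z, f (y, z) ∂(P.map x) = 0) {G : β → ℝ} (hG : Measurable G)
    (hGi : Integrable (fun ω => G (Y ω)) P) :
    ∫ ω, G (Y ω) * f (Y ω, x ω) ∂P = 0 := by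
  have hF : Measurable fun q : β × X => G q.1 * f q := (hG.comp measurable_fst).mul hf
  have hint : Integrable (fun ω => G (Y ω) * f (Y ω, x ω)) P :=
    hGi.mul_bdd (c := C) (hf.comp (hY.prodMk hx)).aestronglyMeasurable
      (ae_of_all _ fun ω => by simpa using hC _)
  have hlaw := (indepFun_iff_map_prod_eq_prod_map_map hY.aemeasurable hx.aemeasurable).mp hind
  have : IsProbabilityMeasure (P.map x) := Measure.isProbabilityMeasure_map hx.aemeasurable
  have : IsProbabilityMeasure (P.map Y) := Measure.isProbabilityMeasure_map hY.aemeasurable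
  have hint' : Integrable (fun q : β × X => G q.1 * f q) ((P.map Y).prod (P.map x)) := by
    rw [← hlaw]
    exact (integrable_map_measure hF.aestronglyMeasurable (hY.prodMk hx).aemeasurable).mpr hint
  have h1 : ∫ ω, G (Y ω) * f (Y ω, x ω) ∂P =
      ∫ q, G q.1 * f q ∂(P.map fun ω => (Y ω, x ω)) :=
    (integral_map (hY.prodMk hx).aemeasurable hF.aestronglyMeasurable).symm
  rw [h1, hlaw, integral_prod _ hint']
  simp [integral_const_mul, hf0]

/-- A random variable minus its conditional expectation is orthogonal to the conditioning
σ-algebra. -/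
theorem integral_mul_sub_eq_zero_of_condExp {Ω : Type u} {m mΩ : MeasurableSpace Ω} (hm : m ≤ mΩ)
    {P : Measure Ω} [IsProbabilityMeasure P] {c e G : Ω → ℝ} (hce : P[c | m] =ᵐ[P] e) (hG : Measurable[m] G) (hc : Integrable c P)
    (hGc : Integrable (G * c) P) (hGe : Integrable (G * e) P) :
    ∫ ω, G ω * (c ω - e ω) ∂P = 0 := by
  have h1 : ∫ ω, (G * c) ω ∂P = ∫ ω, (G * e) ω ∂P := by
    rw [← integral_condExp hm]
    refine integral_congr_ae ?_
    filter_upwards [condExp_mul_of_stronglyMeasurable_left hG.stronglyMeasurable hGc hc, hce]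
      with ω h1 h2
    rw [h1, Pi.mul_apply, Pi.mul_apply, h2]
  have h2 : ∀ ω, G ω * (c ω - e ω) = (G * c) ω - (G * e) ω := fun ω => by
    simp only [Pi.mul_apply]; ring
  simp only [h2]
  rw [integral_sub hGc hGe, h1, sub_self]

end Orthogonality

/-! ### Deviation bounds for cost noise and truncated gaps -/

section Deviations

variable {Ω : Type u} {X : Type v} {A : Type w} {d : ℕ} [MeasurableSpace Ω] [MeasurableSpace X]
  [MeasurableSpace A] [Fintype A] [MeasurableSingletonClass A]
  {P : Measure Ω} [IsProbabilityMeasure P] {p : Problem X A d} {I : Interaction Ω X A d} {T : ℕ}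

/-- The excess of the cost in round `t + 1` over its conditional expectation. -/
noncomputable def costNoise (p : Problem X A d) (I : Interaction Ω X A d) (i : Fin d) (t : ℕ)
    (ω : Ω) : ℝ :=
  I.cost (t + 1) ω i - p.cost (I.context (t + 1) ω) (I.action (t + 1) ω) i

theorem measurable_costNoise {t : ℕ} (h : Measurable (I.history t)) {s : ℕ} (hs : s < t)
    (i : Fin d) : Measurable (costNoise p I i s) :=
  (measurable_pi_iff.mp (Interaction.measurable_cost_of_history h hs) i).sub
    (p.measurable_cost_comp (Interaction.measurable_context_of_history h hs)
      (Interaction.measurable_action_of_history h hs) i)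

theorem measureReal_costNoise_ge_le (hI : I.Follows p P T) (hT : 0 < T) (i : Fin d) {n : ℕ}
    (hn : n ≤ T) {L : ℝ} (hL : 0 ≤ L) :
    P.real {ω | 2 * √(2 * T * L) ≤ ∑ t ∈ Finset.range n, costNoise p I i t ω} ≤
      Real.exp (-L) := by
  have hmeas : ∀ k < n, Measurable (costNoise p I i k) := fun k hk =>
    measurable_costNoise (hI.measurable_history (t := n) hn) hk i
  have hcb : ∀ k < n, ∀ ω, |I.cost (k + 1) ω i| ≤ 1 := fun k hk ω =>
    have h := hI.cost_mem k (by omega) ω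
    abs_le.mpr ⟨h.1 i, h.2 i⟩
  have heb : ∀ k, ∀ ω, |p.cost (I.context (k + 1) ω) (I.action (k + 1) ω) i| ≤ 1 := fun k ω =>
    have h := p.cost_mem (I.context (k + 1) ω) (I.action (k + 1) ω)
    abs_le.mpr ⟨h.1 i, h.2 i⟩
  have hbound : ∀ k < n, ∀ ω, |costNoise p I i k ω| ≤ 2 := fun k hk ω =>
    (abs_sub _ _).trans (by linarith [hcb k hk ω, heb k ω])
  refine measureReal_sum_ge_le_exp_neg hn hT two_pos hmeas hbound (fun s k hk => ?_) hL
  have hkT : k < T := by omega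
  have hinfo : I.info k ≤ ‹MeasurableSpace Ω› :=
    Measurable.comap_le ((hI.measurable_history hkT.le).prodMk
      ((hI.measurable_context k hkT).prodMk (hI.measurable_action k hkT)))
  have hhist : Measurable[I.info k] (I.history k) :=
    (comap_measurable (fun ω => (I.history k ω, I.context (k + 1) ω, I.action (k + 1) ω))).fst
  have hG : Measurable[I.info k]
      fun ω => Real.exp (s * ∑ j ∈ Finset.range k, costNoise p I i j ω) := by
    refine Measurable.exp (Measurable.const_mul (Finset.measurable_sum _ fun j hj => ?_) s)
    -- Past noise is measurable already for the conditioning σ-algebra, so the lemma is applied with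
    -- that σ-algebra in place of the ambient one.
    exact @measurable_costNoise Ω X A d (I.info k) _ _ _ _ p I k hhist j
      (Finset.mem_range.mp hj) i
  have hGi := integrable_exp_mul_sum (P := P) (n := k) (fun j hj => hmeas j (by omega))
    (fun j hj => hbound j (by omega)) s
  have hcm : Measurable fun ω => I.cost (k + 1) ω i :=
    measurable_pi_iff.mp (hI.measurable_cost k hkT) i
  have hem := p.measurable_cost_comp (hI.measurable_context k hkT) (hI.measurable_action k hkT) i
  refine integral_mul_sub_eq_zero_of_condExp hinfo (hI.condExp_cost k hkT i) hG ?_ ?_ ?_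
  · exact Integrable.of_bound hcm.aestronglyMeasurable 1
      (ae_of_all _ fun ω => by simpa using hcb k hk ω)
  · exact hGi.mul_bdd (c := 1) hcm.aestronglyMeasurable
      (ae_of_all _ fun ω => by simpa using hcb k hk ω)
  · exact hGi.mul_bdd (c := 1) hem.aestronglyMeasurable
      (ae_of_all _ fun ω => by simpa using heb k ω)

variable [Nonempty A]

theorem measurable_truncGap_dualVar (p : Problem X A d) {B' : Fin d → ℝ}
    (hB' : B' ∈ Set.Icc (0 : Fin d → ℝ) 1) (E : EstimationProcedure X A d) (B : Fin d → ℝ)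
    (b γ : ℝ) {δ : ℝ} (hδ : δ ∈ Set.Ioc (0 : ℝ) 1) (l : Fin d → ℝ) (D : ℝ) {t : ℕ}
    (h : Measurable (I.history t)) {s : ℕ} (hs : s < t) :
    Measurable fun ω =>
      truncGap p B' l D (E.dualVar B b γ δ I ω s) (I.context (s + 1) ω) := by
  have h1 := (measurable_truncGap p hB' l D).comp
    ((E.measurable_dualVar B b γ hδ (Interaction.measurable_history_of_le h hs.le)).prodMk
      (Interaction.measurable_context_of_history h hs))
  exact h1

theorem measureReal_truncGap_ge_le {B' : Fin d → ℝ} (hB' : B' ∈ Set.Icc (0 : Fin d → ℝ) 1)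
    (E : EstimationProcedure X A d) (B : Fin d → ℝ) (b γ : ℝ)
    {δ : ℝ} (hδ : δ ∈ Set.Ioc (0 : ℝ) 1)
    (hI : I.Follows p P T) (hctx : I.ContextsDrawnFrom p.ν P T) (hT : 0 < T) (hd : 0 < d)
    (l : Fin d → ℝ) {D : ℝ} (hD : 0 < D) {n : ℕ} (hn : n ≤ T) {L : ℝ} (hL : 0 ≤ L) :
    P.real {ω | 4 * √d * D * √(2 * T * L) ≤ ∑ t ∈ Finset.range n,
        truncGap p B' l D (E.dualVar B b γ δ I ω t) (I.context (t + 1) ω)} ≤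
      Real.exp (-L) := by
  have hd' : (0 : ℝ) < d := by exact_mod_cast hd
  have hmeas : ∀ k < n, Measurable fun ω =>
      truncGap p B' l D (E.dualVar B b γ δ I ω k) (I.context (k + 1) ω) := fun k hk =>
    measurable_truncGap_dualVar p hB' E B b γ hδ l D (hI.measurable_history hn) hk
  have hbound : ∀ k < n, ∀ ω,
      |truncGap p B' l D (E.dualVar B b γ δ I ω k) (I.context (k + 1) ω)| ≤ 4 * √d * D :=
    fun k _ ω => abs_truncGap_le p hB' l hD.le _ _
  refine measureReal_sum_ge_le_exp_neg hn hT (by positivity) hmeas hbound (fun s k hk => ?_) hL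
  have hkT : k < T := by omega
  -- Everything about the past that the increment and its weight depend on; given `Y`, only the
  -- fresh context remains to be integrated.
  set Y : Ω → ℝ × (Fin d → ℝ) := fun ω =>
    (Real.exp (s * ∑ j ∈ Finset.range k,
      truncGap p B' l D (E.dualVar B b γ δ I ω j) (I.context (j + 1) ω)),
      E.dualVar B b γ δ I ω k) with hYdef
  have hYm : ∀ (mΩ : MeasurableSpace Ω), Measurable[mΩ] (I.history k) → Measurable[mΩ] Y := by
    intro mΩ h
    refine Measurable.prodMk (Measurable.exp (Measurable.const_mul
      (Finset.measurable_sum _ fun j hj => measurable_truncGap_dualVar p hB' E B b γ hδ l D h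
        (Finset.mem_range.mp hj)) s)) ?_
    exact E.measurable_dualVar B b γ hδ h
  have hY : Measurable Y := hYm _ (hI.measurable_history hkT.le)
  have hind : IndepFun Y (I.context (k + 1)) P := by
    rw [IndepFun_iff_Indep]
    refine indep_of_indep_of_le_left ((IndepFun_iff_Indep _ _ _).mp (hctx k hkT).2) ?_
    exact Measurable.comap_le (hYm _ (comap_measurable _))
  have hfm : Measurable fun q : (ℝ × (Fin d → ℝ)) × X => truncGap p B' l D q.1.2 q.2 := by
    have h := (measurable_truncGap p hB' l D).comp
      ((measurable_fst.snd.prodMk measurable_snd) :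
        Measurable fun q : (ℝ × (Fin d → ℝ)) × X => (q.1.2, q.2))
    exact h
  have hf0 : ∀ y : ℝ × (Fin d → ℝ), ∫ z, truncGap p B' l D y.2 z ∂(P.map (I.context (k + 1))) = 0 :=
    fun y => by rw [(hctx k hkT).1, integral_truncGap p hB' l D]
  have hGi := integrable_exp_mul_sum (P := P) (n := k) (fun j hj => hmeas j (by omega))
    (fun j hj => hbound j (by omega)) s
  have key := integral_mul_eq_zero_of_indepFun hY (hI.measurable_context k hkT) hind hfm
    (fun q => abs_truncGap_le p hB' l hD.le _ _) hf0 measurable_fst hGi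
  exact key

end Deviations

/-! ### Along one path: optimism and descent -/

section Pathwise

variable {Ω : Type u} {X : Type v} {A : Type w} {d : ℕ} [MeasurableSpace X] [MeasurableSpace A]

namespace EstimationProcedure

/-- The estimates along `ω` at times `0, …, T` are within the error functions at level `δ`. -/
def AccurateAt (E : EstimationProcedure X A d) (p : Problem X A d) (I : Interaction Ω X A d)
    (T : ℕ) (δ : ℝ) (ω : Ω) : Prop :=
  ∀ t ≤ T, ∀ (x : X) (a : A),
    |E.rhat t (I.history t ω) x a - p.reward x a| ≤ E.err t (I.pairs t ω) x a δ ∧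
    ∀ i, |E.chat t (I.history t ω) x a i - p.cost x a i| ≤ E.err t (I.pairs t ω) x a δ

/-- The error `ε_t(x_{t+1}, a_{t+1}, δ)` of the round `t + 1`. -/
def roundErr (E : EstimationProcedure X A d) (I : Interaction Ω X A d) (δ : ℝ) (t : ℕ) (ω : Ω) :
    ℝ :=
  E.err t (I.pairs t ω) (I.context (t + 1) ω) (I.action (t + 1) ω) δ

/-- The optimistic cost estimate `ĉ^lcb_{δ,t}(x_{t+1}, a_{t+1})` used in the round `t + 1`. -/
noncomputable def roundCost (E : EstimationProcedure X A d) (I : Interaction Ω X A d) (δ : ℝ)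
    (t : ℕ) (ω : Ω) : Fin d → ℝ :=
  E.clcb δ I t ω (I.context (t + 1) ω) (I.action (t + 1) ω)

variable {E : EstimationProcedure X A d} {p : Problem X A d} {I : Interaction Ω X A d} {T : ℕ}
  {δ : ℝ} {ω : Ω} {B : Fin d → ℝ} {b γ : ℝ}

theorem roundErr_nonneg (hδ : δ ∈ Set.Ioc (0 : ℝ) 1) (t : ℕ) : 0 ≤ E.roundErr I δ t ω :=
  (E.err_mem _ _ _ _ δ hδ).1

theorem sum_roundErr_le_beta (hδ : δ ∈ Set.Ioc (0 : ℝ) 1) {t : ℕ} (ht : t ≤ T) :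
    ∑ s ∈ Finset.range t, E.roundErr I δ s ω ≤ E.beta I T δ ω :=
  Finset.sum_le_sum_of_subset_of_nonneg (Finset.range_mono ht)
    fun s _ _ => roundErr_nonneg hδ s

theorem clcb_mem (E : EstimationProcedure X A d) (δ : ℝ) (I : Interaction Ω X A d) (t : ℕ) (ω : Ω)
    (x : X) (a : A) : E.clcb δ I t ω x a ∈ Set.Icc (-1 : Fin d → ℝ) 1 :=
  ⟨fun _ => le_min (le_max_right _ _) (by norm_num), fun _ => min_le_right _ _⟩

namespace AccurateAt

theorem reward_le_rucb (h : E.AccurateAt p I T δ ω) {t : ℕ} (ht : t ≤ T) (x : X) (a : A) :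
    p.reward x a ≤ E.rucb δ I t ω x a := by
  refine le_min (le_max_of_le_left ?_) (p.reward_mem x a).2
  linarith [(abs_le.mp (h t ht x a).1).1]

theorem rucb_le (h : E.AccurateAt p I T δ ω) (hδ : δ ∈ Set.Ioc (0 : ℝ) 1) {t : ℕ} (ht : t ≤ T)
    (x : X) (a : A) :
    E.rucb δ I t ω x a ≤ p.reward x a + 2 * E.err t (I.pairs t ω) x a δ := by
  have h0 := (E.err_mem t (I.pairs t ω) x a δ hδ).1
  refine (min_le_left _ _).trans (max_le ?_ ?_)
  · linarith [(abs_le.mp (h t ht x a).1).2]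
  · linarith [(p.reward_mem x a).1]

theorem clcb_le_cost (h : E.AccurateAt p I T δ ω) {t : ℕ} (ht : t ≤ T) (x : X) (a : A) :
    E.clcb δ I t ω x a ≤ p.cost x a := by
  intro i
  refine (min_le_left _ _).trans (max_le ?_ ((p.cost_mem x a).1 i))
  linarith [(abs_le.mp ((h t ht x a).2 i)).2]

theorem cost_le_clcb (h : E.AccurateAt p I T δ ω) (hδ : δ ∈ Set.Ioc (0 : ℝ) 1) {t : ℕ}
    (ht : t ≤ T) (x : X) (a : A) (i : Fin d) :
    p.cost x a i ≤ E.clcb δ I t ω x a i + 2 * E.err t (I.pairs t ω) x a δ := by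
  have h0 := (E.err_mem t (I.pairs t ω) x a δ hδ).1
  rw [← sub_le_iff_le_add]
  refine le_min (le_max_of_le_left ?_) ?_
  · linarith [(abs_le.mp ((h t ht x a).2 i)).1]
  · have : p.cost x a i ≤ 1 := (p.cost_mem x a).2 i
    linarith

end AccurateAt

theorem dualVar_succ (t : ℕ) : E.dualVar B b γ δ I ω (t + 1) =
    (E.dualVar B b γ δ I ω t + γ • (E.roundCost I δ t ω - withMargin B b))⁺ := rfl

theorem dualVar_nonneg (t : ℕ) : 0 ≤ E.dualVar B b γ δ I ω t := by
  cases t with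
  | zero => exact le_rfl
  | succ t => exact posPart_nonneg _

/-- The dual variables dominate the accumulated excess of the estimated costs. -/
theorem smul_sum_roundCost_sub_le_dualVar (t : ℕ) (i : Fin d) :
    γ * (∑ s ∈ Finset.range t, E.roundCost I δ s ω i - t * withMargin B b i) ≤
      E.dualVar B b γ δ I ω t i := by
  induction t with
  | zero => simp [dualVar]
  | succ t ih =>
    have h : (E.dualVar B b γ δ I ω t + γ • (E.roundCost I δ t ω - withMargin B b)) i ≤
        E.dualVar B b γ δ I ω (t + 1) i := by
      rw [dualVar_succ]
      exact Pi.le_def.mp (le_posPart _) i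
    simp only [Pi.add_apply, Pi.smul_apply, Pi.sub_apply, smul_eq_mul] at h
    rw [Finset.sum_range_succ]
    push_cast
    linarith

theorem euclNorm_roundCost_sub_le (hB : withMargin B b ∈ Set.Icc (0 : Fin d → ℝ) 1) (t : ℕ) :
    euclNorm (E.roundCost I δ t ω - withMargin B b) ≤ 2 * √d :=
  euclNorm_sub_le_two_mul_sqrt (E.clcb_mem δ I t ω _ _) hB

/-- A step moves by at most `2 * γ * √d` and projection does not increase the distance to `l`. This
crude drift is why `T` truncation levels suffice. -/
theorem euclNorm_dualVar_sub_le (hB : withMargin B b ∈ Set.Icc (0 : Fin d → ℝ) 1) (hγ : 0 < γ)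
    {l : Fin d → ℝ} (hl : 0 ≤ l) (t : ℕ) :
    euclNorm (E.dualVar B b γ δ I ω t - l) ≤ euclNorm l + 2 * γ * √d * t := by
  induction t with
  | zero => simp [dualVar, euclNorm_neg]
  | succ t ih =>
    have h1 : euclNorm (E.dualVar B b γ δ I ω (t + 1) - l) ≤
        euclNorm (E.dualVar B b γ δ I ω t - l) +
          γ * euclNorm (E.roundCost I δ t ω - withMargin B b) := by
      rw [dualVar_succ]
      refine (euclNorm_posPart_sub_le hl _).trans ?_
      rw [add_sub_right_comm]
      refine (euclNorm_add_le _ _).trans (le_of_eq ?_)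
      rw [euclNorm_smul, abs_of_pos hγ]
    have h2 := mul_le_mul_of_nonneg_left
      (euclNorm_roundCost_sub_le (E := E) (I := I) (δ := δ) (ω := ω) hB t) hγ.le
    push_cast
    linarith

theorem euclNorm_dualVar_sub_sq_le (hB : withMargin B b ∈ Set.Icc (0 : Fin d → ℝ) 1)
    {l : Fin d → ℝ} (hl : 0 ≤ l) (t : ℕ) :
    euclNorm (E.dualVar B b γ δ I ω t - l) ^ 2 ≤ euclNorm l ^ 2 +
      2 * γ * ∑ s ∈ Finset.range t,
        (E.roundCost I δ s ω - withMargin B b) ⬝ᵥ (E.dualVar B b γ δ I ω s - l) +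
      4 * d * t * γ ^ 2 := by
  induction t with
  | zero => simp [dualVar, euclNorm_neg]
  | succ t ih =>
    have h1 := euclNorm_posPart_step_sq_le hl (E.dualVar B b γ δ I ω t)
      (E.roundCost I δ t ω - withMargin B b) γ
    have h2 : euclNorm (E.roundCost I δ t ω - withMargin B b) ^ 2 ≤ 4 * d := by
      refine (pow_le_pow_left₀ (euclNorm_nonneg _) (euclNorm_roundCost_sub_le hB t) 2).trans
        (le_of_eq ?_)
      rw [mul_pow, Real.sq_sqrt (Nat.cast_nonneg d)]
      norm_num
    have h3 := mul_le_mul_of_nonneg_left h2 (sq_nonneg γ)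
    rw [dualVar_succ, Finset.sum_range_succ]
    push_cast
    linarith

variable [Fintype A] [Nonempty A]

/-- Optimism: the played action nearly maximizes the true Lagrangian at the dual variable. -/
theorem AccurateAt.roundCost_dotProduct_le (h : E.AccurateAt p I T δ ω)
    (hδ : δ ∈ Set.Ioc (0 : ℝ) 1) (hplay : E.PlayedBy B b γ δ I T) {l : Fin d → ℝ} (hl : 0 ≤ l)
    {t : ℕ} (ht : t < T) :
    (E.roundCost I δ t ω - withMargin B b) ⬝ᵥ (E.dualVar B b γ δ I ω t - l) ≤
      lagrangianMax p (withMargin B b) l (I.context (t + 1) ω) -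
        lagrangianMax p (withMargin B b) (E.dualVar B b γ δ I ω t) (I.context (t + 1) ω) +
      2 * (1 + √d * euclNorm l) * E.roundErr I δ t ω := by
  set x := I.context (t + 1) ω with hx
  set a := I.action (t + 1) ω with ha
  set m := E.dualVar B b γ δ I ω t with hm
  have hε : 0 ≤ E.roundErr I δ t ω := roundErr_nonneg hδ t
  have h1 : lagrangianMax p (withMargin B b) m x ≤ E.score B b γ δ I t ω a := by
    -- The estimates are optimistic for every action and the multiplier is nonnegative, so the score
    -- dominates the true Lagrangian; the played action maximizes the score.
    refine lagrangianMax_le fun a' => (?_ : _ ≤ E.score B b γ δ I t ω a').trans (hplay t ht ω a')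
    have hr := h.reward_le_rucb ht.le x a'
    have hc : (E.clcb δ I t ω x a' - withMargin B b) ⬝ᵥ m ≤
        (p.cost x a' - withMargin B b) ⬝ᵥ m :=
      dotProduct_le_dotProduct_of_nonneg_right
        (sub_le_sub_right (h.clcb_le_cost ht.le x a') _) (dualVar_nonneg t)
    rw [score]
    linarith
  have h2 : E.rucb δ I t ω x a ≤ p.reward x a + 2 * E.roundErr I δ t ω :=
    h.rucb_le hδ ht.le x a
  have h3 : (p.cost x a - withMargin B b) ⬝ᵥ l ≤
      (E.roundCost I δ t ω - withMargin B b) ⬝ᵥ l + 2 * E.roundErr I δ t ω * ∑ i, l i := by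
    simp only [dotProduct, Finset.mul_sum, ← Finset.sum_add_distrib]
    refine Finset.sum_le_sum fun i _ => ?_
    rw [← add_mul]
    refine mul_le_mul_of_nonneg_right ?_ (hl i)
    have : p.cost x a i ≤ E.roundCost I δ t ω i + 2 * E.roundErr I δ t ω :=
      h.cost_le_clcb hδ ht.le x a i
    simp only [Pi.sub_apply]
    linarith
  have h4 := le_lagrangianMax p (withMargin B b) l x a
  have h5 : 2 * E.roundErr I δ t ω * ∑ i, l i ≤
      2 * E.roundErr I δ t ω * (√d * euclNorm l) :=
    mul_le_mul_of_nonneg_left (sum_le_sqrt_mul_euclNorm l) (by positivity)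
  have h6 : E.score B b γ δ I t ω a =
      E.rucb δ I t ω x a - (E.roundCost I δ t ω - withMargin B b) ⬝ᵥ m := rfl
  rw [dotProduct_sub]
  linarith

end EstimationProcedure

end Pathwise

/-! ### Along one path: bounds on the multipliers and on the overrun -/

section Pathwise

variable {Ω : Type u} {X : Type v} {A : Type w} {d : ℕ} [MeasurableSpace X] [MeasurableSpace A]

/-- Completing the square: the right side becomes `(D - 3g)² ≤ K² + 16g² + 4g + 4gK`, which is at
most `(K + 1 + 4g)²`. -/
theorem le_of_sq_le_quadratic {D K g : ℝ} (hK : 0 ≤ K) (hg : 0 ≤ g)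
    (h : D ^ 2 ≤ K ^ 2 + 6 * g * D + 7 * g ^ 2 + 4 * g + 4 * g * K) : D ≤ K + 1 + 7 * g := by
  have h1 : (D - 3 * g) ^ 2 ≤ (K + 1 + 4 * g) ^ 2 := by nlinarith [mul_nonneg hK hg]
  have h2 := (abs_le_of_sq_le_sq' h1 (by positivity)).2
  linarith

namespace EstimationProcedure

variable {E : EstimationProcedure X A d} {p : Problem X A d} {I : Interaction Ω X A d} {T : ℕ}
  {δ : ℝ} {ω : Ω} {B : Fin d → ℝ} {b γ : ℝ}

/-- If the centered dual gaps truncated at the levels `‖l‖ + 2 γ √d (k + 1)` do not deviate much,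
the dual variables stay close to a dual optimum `l`. -/
theorem AccurateAt.euclNorm_dualVar_sub_le [Fintype A] [Nonempty A] (h : E.AccurateAt p I T δ ω)
    (hδ : δ ∈ Set.Ioc (0 : ℝ) 1) (hplay : E.PlayedBy B b γ δ I T)
    (hB : withMargin B b ∈ Set.Icc (0 : Fin d → ℝ) 1) (hγ : 0 < γ) (hd : 0 < d) (hT : 0 < T)
    {l : Fin d → ℝ} (hl : IsDualOptimal p (withMargin B b) l) {L U : ℝ} (hL : 1 ≤ L)
    (hβ : E.beta I T δ ω ≤ U) (hU : 2 * √(d * T * L) ≤ U)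
    (hgap : ∀ k < T, ∀ n < T, ∑ t ∈ Finset.range (n + 1),
      truncGap p (withMargin B b) l (euclNorm l + 2 * γ * √d * (k + 1))
        (E.dualVar B b γ δ I ω t) (I.context (t + 1) ω) ≤
      4 * √d * (euclNorm l + 2 * γ * √d * (k + 1)) * √(2 * T * L))
    {t : ℕ} (ht : t ≤ T) :
    euclNorm (E.dualVar B b γ δ I ω t - l) ≤ euclNorm l + 1 + 7 * (γ * √d * U) := by
  have hd1 : (1 : ℝ) ≤ d := by exact_mod_cast hd
  have hT1 : (1 : ℝ) ≤ T := by exact_mod_cast hT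
  set N : ℕ → ℝ := fun s => euclNorm (E.dualVar B b γ δ I ω s - l) with hN
  set K := euclNorm l with hK
  set q := √(d : ℝ) with hq
  have hK0 : 0 ≤ K := euclNorm_nonneg l
  have hq1 : 1 ≤ q := Real.one_le_sqrt.mpr hd1
  have hq2 : q ^ 2 = d := Real.sq_sqrt (by positivity)
  have hdTL : (0 : ℝ) ≤ d * T * L := by positivity
  have hU0 : 0 ≤ U := le_trans (by positivity) hU
  have hU2 : 4 * (d * T * L) ≤ U ^ 2 := by
    have h1 := pow_le_pow_left₀ (by positivity) hU 2
    rw [mul_pow, Real.sq_sqrt hdTL] at h1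
    linarith
  have hUdT : 4 * d * T ≤ U ^ 2 := by
    have : (d * T : ℝ) * 1 ≤ d * T * L := mul_le_mul_of_nonneg_left hL (by positivity)
    linarith
  have hUq : 2 * q ≤ U := by
    refine abs_le_of_sq_le_sq' ?_ hU0 |>.2
    have : (d : ℝ) * 1 ≤ d * T := mul_le_mul_of_nonneg_left hT1 (by positivity)
    rw [mul_pow, hq2]
    linarith
  -- After squaring: `32 * d * T * L ≤ 36 * d * T * L ≤ 9 * U ^ 2`.
  have hW : 4 * q * √(2 * T * L) ≤ 3 * U := by
    refine abs_le_of_sq_le_sq' ?_ (by positivity) |>.2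
    rw [mul_pow, mul_pow, hq2, Real.sq_sqrt (by positivity), mul_pow]
    linarith
  obtain ⟨n, hn, hmax⟩ := Finset.exists_max_image (Finset.range (T + 1)) N ⟨0, by simp⟩
  have hnT : n ≤ T := by simpa [Nat.lt_succ_iff] using hn
  refine (hmax t (by simpa [Nat.lt_succ_iff] using ht)).trans ?_
  have hg0 : 0 ≤ γ * q * U := by positivity
  have hN0 : N 0 = K := by simp [hN, dualVar, euclNorm_neg, hK]
  rcases Nat.eq_zero_or_pos n with rfl | hn0
  · rw [hN0]; linarith
  have hKN : K ≤ N n := hN0 ▸ hmax 0 (by simp)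
  have hstep : 0 < 2 * γ * q := by positivity
  -- The level just above the maximal distance `N n`: high enough for no truncation before time `n`,
  -- and at most one spacing too high. If rounding yields an index beyond the grid, the top level
  -- works by the crude drift bound.
  obtain ⟨k, hkT, hkN, hDN⟩ : ∃ k < T, (∀ s < n, N s ≤ K + 2 * γ * q * (k + 1)) ∧
      K + 2 * γ * q * (k + 1) ≤ N n + 2 * γ * q := by
    have hfl := Nat.floor_le (div_nonneg (sub_nonneg.mpr hKN) hstep.le)
    have hfl' := Nat.lt_floor_add_one ((N n - K) / (2 * γ * q))
    set j := ⌊(N n - K) / (2 * γ * q)⌋₊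
    rw [le_div_iff₀ hstep] at hfl
    rw [div_lt_iff₀ hstep] at hfl'
    rcases lt_or_ge j T with hj | hj
    · refine ⟨j, hj, fun s hs => ?_, by linarith⟩
      have := hmax s (Finset.mem_range.mpr (by omega))
      linarith
    · have hcast : ((T - 1 : ℕ) : ℝ) + 1 = T := by
        rw [Nat.cast_sub hT]; simp
      refine ⟨T - 1, by omega, fun s hs => ?_, ?_⟩
      · rw [hcast]
        refine (EstimationProcedure.euclNorm_dualVar_sub_le hB hγ hl.1 s).trans ?_
        have : (s : ℝ) ≤ T := by exact_mod_cast (by omega : s ≤ T)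
        have := mul_le_mul_of_nonneg_left this hstep.le
        linarith
      · rw [hcast]
        have : (T : ℝ) ≤ j := by exact_mod_cast hj
        have := mul_le_mul_of_nonneg_left this hstep.le
        linarith
  set D := K + 2 * γ * q * (k + 1) with hD
  have hD0 : 0 ≤ D := by positivity
  have hsum : ∑ s ∈ Finset.range n,
      (E.roundCost I δ s ω - withMargin B b) ⬝ᵥ (E.dualVar B b γ δ I ω s - l) ≤
      3 * U * D + 2 * (1 + q * K) * U := by
    calc _ ≤ ∑ s ∈ Finset.range n, (truncGap p (withMargin B b) l D (E.dualVar B b γ δ I ω s)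
          (I.context (s + 1) ω) + 2 * (1 + q * K) * E.roundErr I δ s ω) := by
          refine Finset.sum_le_sum fun s hs => ?_
          have hs' := Finset.mem_range.mp hs
          have h1 := h.roundCost_dotProduct_le hδ hplay hl.1 (hs'.trans_le hnT)
          have h2 := hl.2 _ (dualVar_nonneg (E := E) (B := B) (b := b) (γ := γ) (δ := δ) (I := I)
            (ω := ω) s)
          rw [truncGap, if_pos (hkN s hs')]
          -- Optimality of `l` makes the subtracted mean gap nonpositive, so centering only
          -- increases the bound.
          linarith
      _ = _ + 2 * (1 + q * K) * ∑ s ∈ Finset.range n, E.roundErr I δ s ω := by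
          rw [Finset.sum_add_distrib, ← Finset.mul_sum]
      _ ≤ 3 * U * D + 2 * (1 + q * K) * U := by
          refine add_le_add ?_ (mul_le_mul_of_nonneg_left
            ((sum_roundErr_le_beta hδ hnT).trans hβ) (by positivity))
          have h1 := hgap k hkT (n - 1) (by omega)
          rw [Nat.sub_add_cancel hn0] at h1
          refine h1.trans ?_
          have h2 := mul_le_mul_of_nonneg_right hW hD0
          linarith
  have hsq := EstimationProcedure.euclNorm_dualVar_sub_sq_le (E := E) (I := I) (δ := δ) (ω := ω)
    (γ := γ) hB hl.1 n
  have hγU : γ * U ≤ γ * q * U := by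
    have := mul_le_mul_of_nonneg_left hq1 (mul_nonneg hγ.le hU0)
    linarith
  have hγU0 : 0 ≤ γ * U := by positivity
  have hγU2 : (γ * U) ^ 2 ≤ (γ * q * U) ^ 2 := pow_le_pow_left₀ hγU0 hγU 2
  have hNn0 : 0 ≤ N n := euclNorm_nonneg _
  -- Here `g = γ * q * U`. Of the `7 * g ^ 2`, six come from the spacing between `D` and `N n`
  -- (using `2 * q ≤ U`) and one from the squared gradients.
  refine le_of_sq_le_quadratic hK0 hg0 ?_
  have e1 : 2 * γ * (∑ s ∈ Finset.range n,
      (E.roundCost I δ s ω - withMargin B b) ⬝ᵥ (E.dualVar B b γ δ I ω s - l)) ≤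
      2 * γ * (3 * U * D + 2 * (1 + q * K) * U) := mul_le_mul_of_nonneg_left hsum (by positivity)
  have e2 : 6 * (γ * U) * D ≤ 6 * (γ * U) * (N n + 2 * γ * q) :=
    mul_le_mul_of_nonneg_left hDN (by positivity)
  have e3 : (γ * U) * N n ≤ (γ * q * U) * N n := mul_le_mul_of_nonneg_right hγU hNn0
  have e4 : (γ * U) * (γ * (2 * q)) ≤ (γ * U) * (γ * U) :=
    mul_le_mul_of_nonneg_left (mul_le_mul_of_nonneg_left hUq hγ.le) hγU0
  have e5 : 4 * d * n * γ ^ 2 ≤ U ^ 2 * γ ^ 2 := by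
    refine mul_le_mul_of_nonneg_right (le_trans ?_ hUdT) (sq_nonneg γ)
    have : (n : ℝ) ≤ T := by exact_mod_cast hnT
    exact mul_le_mul_of_nonneg_left this (by positivity)
  have e6 : N n ^ 2 ≤ _ := hsq
  nlinarith [e1, e2, e3, e4, e5, e6, hγU, hγU2]

/-- The accumulated cost overrun is controlled by the dual variable and the deviations. -/
theorem AccurateAt.euclNorm_posPart_sum_cost_le (h : E.AccurateAt p I T δ ω)
    (hδ : δ ∈ Set.Ioc (0 : ℝ) 1) (hγ : 0 < γ) {U : ℝ} (hU0 : 0 ≤ U)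
    (hβ : E.beta I T δ ω ≤ U) {t : ℕ} (ht : t ≤ T)
    (hnoise : ∀ i, ∑ s ∈ Finset.range t, costNoise p I i s ω ≤ 2 * U) :
    euclNorm (∑ τ ∈ Finset.Icc 1 t, I.cost τ ω - (t : ℝ) • withMargin B b)⁺ ≤
      euclNorm (E.dualVar B b γ δ I ω t) / γ + 4 * √d * U := by
  have hle : ∀ i, (∑ τ ∈ Finset.Icc 1 t, I.cost τ ω - (t : ℝ) • withMargin B b) i ≤
      (γ⁻¹ • E.dualVar B b γ δ I ω t + fun _ => 4 * U : Fin d → ℝ) i := by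
    intro i
    have h1 : (∑ τ ∈ Finset.Icc 1 t, I.cost τ ω) i = ∑ s ∈ Finset.range t, I.cost (s + 1) ω i := by
      rw [Finset.sum_apply, Finset.range_eq_Ico,
        Finset.sum_Ico_add' (fun s => I.cost s ω i) 0 t 1]
      rfl
    have h2 : ∑ s ∈ Finset.range t, I.cost (s + 1) ω i ≤
        ∑ s ∈ Finset.range t, (costNoise p I i s ω + E.roundCost I δ s ω i +
          2 * E.roundErr I δ s ω) := by
      refine Finset.sum_le_sum fun s hs => ?_
      have h3 := h.cost_le_clcb hδ ((Finset.mem_range.mp hs).le.trans ht)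
        (I.context (s + 1) ω) (I.action (s + 1) ω) i
      rw [costNoise, roundCost, roundErr]
      linarith
    rw [Finset.sum_add_distrib, Finset.sum_add_distrib, ← Finset.mul_sum] at h2
    have h4 := sum_roundErr_le_beta (E := E) (I := I) (ω := ω) hδ ht
    have h5 := smul_sum_roundCost_sub_le_dualVar (E := E) (I := I) (ω := ω) (δ := δ) (B := B)
      (b := b) (γ := γ) t i
    rw [← le_inv_mul_iff₀ hγ] at h5
    simp only [Pi.sub_apply, Pi.add_apply, Pi.smul_apply, smul_eq_mul, h1]
    -- The allowance `4 * U` is `2 * U` for the noise plus `2 * U` for twice the summed errors.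
    linarith [hnoise i]
  have hnn : ∀ i, 0 ≤ (γ⁻¹ • E.dualVar B b γ δ I ω t + fun _ => 4 * U : Fin d → ℝ) i := fun i =>
    add_nonneg (mul_nonneg (inv_nonneg.mpr hγ.le) (dualVar_nonneg t i)) (by positivity)
  calc _ ≤ euclNorm (γ⁻¹ • E.dualVar B b γ δ I ω t + fun _ => 4 * U) := by
        refine euclNorm_le_of_abs_le fun i => ?_
        rw [Pi.posPart_apply, abs_of_nonneg (posPart_nonneg _), abs_of_nonneg (hnn i)]
        exact sup_le (hle i) (hnn i)
    _ ≤ _ := euclNorm_add_le _ _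
    _ = _ := by
        rw [euclNorm_smul, euclNorm_const, abs_of_pos (inv_pos.mpr hγ),
          abs_of_nonneg (by positivity : (0 : ℝ) ≤ 4 * U)]
        ring

end EstimationProcedure

end Pathwise

/-! ### Discarding bad events -/

section Probability

variable {Ω : Type u} [MeasurableSpace Ω] {P : Measure Ω}

theorem HoldsWithProb.mono {q : ℝ} {S S' : Set Ω} (h : HoldsWithProb P q S) (hS : S ⊆ S')
    {q' : ℝ} (hq : q' ≤ q) : HoldsWithProb P q' S' := by
  obtain ⟨F, hF, hFS, hPF⟩ := h
  exact ⟨F, hF, hFS.trans hS, (ENNReal.ofReal_le_ofReal hq).trans hPF⟩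

/-- Removing finitely many bad events of probability at most `r` each. -/
theorem HoldsWithProb.diff_biUnion [IsProbabilityMeasure P] {q : ℝ} {S : Set Ω} (h : HoldsWithProb P q S) {ι : Type*}
    (s : Finset ι) {F : ι → Set Ω} (hF : ∀ i ∈ s, MeasurableSet (F i)) {r : ℝ}
    (hr : ∀ i ∈ s, P.real (F i) ≤ r) :
    HoldsWithProb P (q - s.card * r) (S \ ⋃ i ∈ s, F i) := by
  obtain ⟨G, hG, hGS, hPG⟩ := h
  refine ⟨G \ ⋃ i ∈ s, F i, hG.diff (s.measurableSet_biUnion hF),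
    Set.sdiff_subset_sdiff_left hGS, ?_⟩
  -- Only the measurable event `G` inside `S` is handled, so `S` itself need not be measurable.
  rw [ENNReal.ofReal_le_iff_le_toReal (measure_ne_top _ _)] at hPG ⊢
  have h1 : P.real (⋃ i ∈ s, F i) ≤ s.card * r := by
    refine (measureReal_biUnion_finset_le s F).trans ((Finset.sum_le_sum hr).trans ?_)
    simp
  have h2 : P.real G - P.real (⋃ i ∈ s, F i) ≤ P.real (G \ ⋃ i ∈ s, F i) :=
    le_measureReal_sdiff (measure_ne_top _ _)
  simp only [Measure.real] at h1 h2
  linarith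

end Probability

end CBwK

/-! ### Assembly by a union bound -/

theorem lemma1 {Ω : Type u} {X : Type v} {A : Type w} {d : ℕ}
    [MeasurableSpace Ω] [MeasurableSpace X]
    [Fintype A] [Nonempty A] [MeasurableSpace A] [MeasurableSingletonClass A]
    (P : Measure Ω) [IsProbabilityMeasure P]
    (p : CBwK.Problem X A d) (B : Fin d → ℝ) (hB : B ∈ Set.Icc (0 : Fin d → ℝ) 1)
    (T : ℕ) (δ : ℝ) (hδ : δ ∈ Set.Ioo (0 : ℝ) 1)
    (b : ℝ) (hb : 0 < b) (hbB : ∀ i, b < B i) (γ : ℝ) (hγ : 0 < γ)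
    (hfeas : ∃ B' : Fin d → ℝ, (∀ i, B' i < B i - b) ∧ CBwK.Feasible p B')
    (E : CBwK.EstimationProcedure X A d)
    (hE : CBwK.EstimationProcedure.IsAccurate.{u} E p T)
    (I : CBwK.Interaction Ω X A d) (hI : I.Follows p P T)
    (hctx : I.ContextsDrawnFrom p.ν P T)
    (hplay : E.PlayedBy B b γ (δ / 4) I T) :
    (∃ l, CBwK.IsDualOptimal p (CBwK.withMargin B b) l) ∧
    ∀ l, CBwK.IsDualOptimal p (CBwK.withMargin B b) l →
      CBwK.HoldsWithProb P (1 - δ) {ω | ∀ t, 1 ≤ t → t ≤ T →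
        CBwK.euclNorm
            (∑ τ ∈ Finset.Icc 1 t, I.cost τ ω - (t : ℝ) • CBwK.withMargin B b)⁺ ≤
          (1 + 3 * CBwK.euclNorm l) / γ + 20 * √(d : ℝ) * E.upsilon I T δ ω} := by
  have hB' : CBwK.withMargin B b ∈ Set.Icc (0 : Fin d → ℝ) 1 :=
    ⟨fun i => (sub_pos.mpr (hbB i)).le, fun i => by
      have : B i ≤ 1 := hB.2 i
      simp only [CBwK.withMargin, Pi.one_apply]
      linarith⟩
  refine ⟨?_, fun l hl => ?_⟩
  · obtain ⟨B', hlt, hf⟩ := hfeas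
    exact CBwK.exists_isDualOptimal p hB' hlt hf
  have hδ4 : δ / 4 ∈ Set.Ioc (0 : ℝ) 1 := ⟨by linarith [hδ.1], by linarith [hδ.2]⟩
  have hacc : CBwK.HoldsWithProb P (1 - δ / 4) {ω | E.AccurateAt p I T (δ / 4) ω} :=
    hE Ω P I hI (δ / 4) hδ4
  have hK0 : 0 ≤ CBwK.euclNorm l := CBwK.euclNorm_nonneg l
  have hU0 : ∀ ω, 0 ≤ E.upsilon I T δ ω := fun ω =>
    le_max_of_le_right (le_max_of_le_right (Real.sqrt_nonneg _))
  rcases Nat.eq_zero_or_pos T with rfl | hT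
  · refine hacc.mono ?_ (by linarith [hδ.1])
    intro ω _ t h1 h2
    omega
  -- Without cost components the overrun has norm 0; elsewhere `d > 0` makes the increment bound for
  -- Azuma–Hoeffding positive.
  rcases Nat.eq_zero_or_pos d with rfl | hd
  · refine hacc.mono ?_ (by linarith [hδ.1])
    intro ω _ t _ _
    have h1 := hU0 ω
    rw [CBwK.euclNorm_eq, Finset.univ_eq_empty, Finset.sum_empty, Real.sqrt_zero]
    positivity
  have hd1 : (1 : ℝ) ≤ d := by exact_mod_cast hd
  have hT1 : (1 : ℝ) ≤ T := by exact_mod_cast hT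
  set L := Real.log ((T : ℝ) ^ 2 / (δ / 4)) with hLdef
  set L' := Real.log (2 * ((d : ℝ) + 1) * T / (δ / 4)) with hLdef'
  have hexpL : Real.exp (-L) = δ / 4 / (T : ℝ) ^ 2 := by
    rw [Real.exp_neg, Real.exp_log (div_pos (by positivity) hδ4.1), inv_div]
  have hexpL' : Real.exp (-L') = δ / 4 / (2 * ((d : ℝ) + 1) * T) := by
    rw [Real.exp_neg, Real.exp_log (div_pos (by positivity) hδ4.1), inv_div]
  -- Running at confidence `δ / 4` puts the argument of the logarithm above 4, hence above `e`.
  have hL : 1 ≤ L := by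
    rw [hLdef, Real.le_log_iff_exp_le (div_pos (by positivity) hδ4.1), le_div_iff₀ hδ4.1]
    nlinarith [Real.exp_one_lt_d9, Real.exp_pos 1, hδ.1, hδ.2]
  have hL' : 0 ≤ L' := by
    refine Real.log_nonneg ?_
    rw [le_div_iff₀ hδ4.1]
    nlinarith [hδ4.2]
  have hDpos : ∀ k : ℕ, 0 < CBwK.euclNorm l + 2 * γ * √(d : ℝ) * (k + 1) := fun k => by
    have : 0 < √(d : ℝ) := Real.sqrt_pos.mpr (by linarith)
    positivity
  -- One event for each level `kn.1` and each prefix length `kn.2 + 1`; these `T ^ 2` events account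
  -- for the square in `L`.
  have hgap := hacc.diff_biUnion (Finset.range T ×ˢ Finset.range T)
    (F := fun kn => {ω | 4 * √d * (CBwK.euclNorm l + 2 * γ * √d * (kn.1 + 1)) * √(2 * T * L) ≤
      ∑ t ∈ Finset.range (kn.2 + 1), CBwK.truncGap p (CBwK.withMargin B b) l
        (CBwK.euclNorm l + 2 * γ * √d * (kn.1 + 1)) (E.dualVar B b γ (δ / 4) I ω t)
        (I.context (t + 1) ω)})
    (r := Real.exp (-L))
    (fun kn hkn => by
      have hn : kn.2 + 1 ≤ T := Finset.mem_range.mp (Finset.mem_product.mp hkn).2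
      refine measurableSet_le measurable_const (Finset.measurable_sum _ fun t ht => ?_)
      exact CBwK.measurable_truncGap_dualVar p hB' E B b γ hδ4 l _ (hI.measurable_history hn)
        (Finset.mem_range.mp ht))
    (fun kn hkn => by
      have hn : kn.2 + 1 ≤ T := Finset.mem_range.mp (Finset.mem_product.mp hkn).2
      exact CBwK.measureReal_truncGap_ge_le hB' E B b γ hδ4 hI hctx hT hd l (hDpos kn.1) hn
        (by linarith))
  have hall := hgap.diff_biUnion ((Finset.univ : Finset (Fin d)) ×ˢ Finset.range T)
    (F := fun ik => {ω | 2 * √(2 * T * L') ≤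
      ∑ t ∈ Finset.range (ik.2 + 1), CBwK.costNoise p I ik.1 t ω})
    (r := Real.exp (-L'))
    (fun ik hik => by
      have hn : ik.2 + 1 ≤ T := Finset.mem_range.mp (Finset.mem_product.mp hik).2
      exact measurableSet_le measurable_const (Finset.measurable_sum _ fun t ht =>
        CBwK.measurable_costNoise (hI.measurable_history hn) (Finset.mem_range.mp ht) ik.1))
    (fun ik hik => by
      have hn : ik.2 + 1 ≤ T := Finset.mem_range.mp (Finset.mem_product.mp hik).2
      exact CBwK.measureReal_costNoise_ge_le hI hT ik.1 hn hL')
  refine hall.mono ?_ ?_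
  · rintro ω ⟨⟨hω, hω1⟩, hω2⟩ t ht1 htT
    simp only [Set.mem_iUnion, Finset.mem_product, Finset.mem_range, Finset.mem_univ,
      Set.mem_ofPred_eq, not_exists, not_le, Prod.forall, true_and, and_imp] at hω1 hω2
    set U := E.upsilon I T δ ω with hUdef
    have hβ : E.beta I T (δ / 4) ω ≤ U := le_max_left _ _
    have hU1 : 2 * √(d * T * L) ≤ U := (le_max_left _ _).trans (le_max_right _ _)
    have hU2 : √(2 * T * L') ≤ U := (le_max_right _ _).trans (le_max_right _ _)
    have h1 := CBwK.EstimationProcedure.AccurateAt.euclNorm_dualVar_sub_le hω hδ4 hplay hB' hγ hd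
      hT hl hL hβ hU1 (fun k hk n hn => (hω1 k n hk hn).le) htT
    have h2 := CBwK.EstimationProcedure.AccurateAt.euclNorm_posPart_sum_cost_le (B := B) (b := b)
      hω hδ4 hγ (hU0 ω) hβ htT fun i => by
        have := hω2 i (t - 1) (by omega)
        rw [Nat.sub_add_cancel ht1] at this
        linarith
    refine h2.trans ?_
    have h3 : CBwK.euclNorm (E.dualVar B b γ (δ / 4) I ω t) ≤
        1 + 2 * CBwK.euclNorm l + 7 * (γ * √d * U) := by
      have h4 := CBwK.euclNorm_add_le (E.dualVar B b γ (δ / 4) I ω t - l) l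
      rw [sub_add_cancel] at h4
      linarith
    have hqU : 0 ≤ √(d : ℝ) * U := mul_nonneg (Real.sqrt_nonneg _) (hU0 ω)
    -- The argument gives `2 * ‖l‖` and, with the `4` above, the constant `11`; the stated `3` and
    -- `20` leave slack.
    have h5 : CBwK.euclNorm (E.dualVar B b γ (δ / 4) I ω t) / γ ≤
        (1 + 3 * CBwK.euclNorm l) / γ + 7 * (√d * U) := by
      rw [div_add' _ _ _ hγ.ne']
      refine div_le_div_of_nonneg_right ?_ hγ.le
      linarith
    linarith
  · have hc1 : ((Finset.range T ×ˢ Finset.range T).card : ℝ) * Real.exp (-L) = δ / 4 := by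
      rw [hexpL, Finset.card_product, Finset.card_range]
      push_cast
      field_simp
    -- Only `d * T` of the `2 * (d + 1) * T` events budgeted in `L'` are used. Accuracy, gaps and
    -- noise cost at most `δ / 4` each, so `3 * δ / 4` in all.
    have hc2 : (((Finset.univ : Finset (Fin d)) ×ˢ Finset.range T).card : ℝ) * Real.exp (-L') ≤
        δ / 4 := by
      rw [hexpL', Finset.card_product, Finset.card_range, Finset.card_univ, Fintype.card_fin]
      push_cast
      rw [mul_div_assoc', div_le_iff₀ (by positivity)]
      nlinarith [mul_pos hδ4.1 (by positivity : (0 : ℝ) < d * T),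
        mul_pos hδ4.1 (by positivity : (0 : ℝ) < T)]
    rw [hc1]
    linarith [hδ.1]
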